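/- Let $L_{2e}^n$ be the space of (a.e. classes of) measurable $f:[0,\infty)\to\mathbb{R}^n$ with $P_Tf\in L_2$ for all $T\ge 0$, and $\ell_{2e}^n$ the space of all sequences $f:\mathbb{Z}_+\to\mathbb{R}^n$. Here $P_T$ is truncation ($(P_Tf)(t)=f(t)$ for $t\le T$ and $0$ otherwise) and $D_T$ is the shift ($(D_Tf)(t)=0$ for $t<T$ and $f(t-T)$ otherwise). These spaces carry the topology generated by the open balls of $\|f\|_T=\|P_Tf\|_2$. Let $\mathcal{L}(\mathcal{X},\mathcal{Z})$ be the space of continuous linear maps, with the topology generated by the open balls of $\|A\|_T=\|P_TA\|_{L_2\to L_2}$ (respectively $\|P_TA\|_{\ell_2\to\ell_2}$), and let $\mathrm{LTI}(\mathcal{X},\mathcal{Z})\subset\mathcal{L}(\mathcal{X},\mathcal{Z})$ be the set of those $A$ that are causal ($P_TAP_T=P_TA$ for all $T\ge0$) and time-invariant ($D_TA=AD_T$ for all $T>0$). Put $\mathcal{W}=L_{2e}^{n_w}$, $\mathcal{U}=L_{2e}^{n_u}$, $\mathcal{Z}=L_{2e}^{n_z}$, $\mathcal{Y}=L_{2e}^{n_y}$.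 Let $P_{11}\in\mathrm{LTI}(\mathcal{W},\mathcal{Z})$, $P_{12}\in\mathrm{LTI}(\mathcal{U},\mathcal{Z})$, $P_{21}\in\mathrm{LTI}(\mathcal{W},\mathcal{Y})$ and $G=P_{22}\in\mathrm{LTI}(\mathcal{U},\mathcal{Y})$ be the blocks of a causal LTI plant $P$. Let $S\subset\mathrm{LTI}(\mathcal{Y},\mathcal{U})$ be a closed linear subspace that is inert with respect to $G$: for every $K\in S$, $GK$ has an impulse response matrix (it acts as convolution with a matrix-valued function on $[0,\infty)$) all of whose entries are essentially bounded on every $[0,T]$. Suppose that $P_{12}$ has a continuous linear left inverse and $P_{21}$ has a continuous linear right inverse. Then $I-GK$ is invertible in $\mathcal{L}(\mathcal{Y},\mathcal{Y})$ for every $K\in S$, so that $h(K)=-K(I-GK)^{-1}$ is defined on $S$, and the following are equivalent: (i) $S$ is quadratically invariant under $G$, i.e. $KGK\in S$ for all $K\in S$; (ii) the set of achievable closed-loop maps $P_{11}-P_{12}\,h(S)\,P_{21}=\{P_{11}-P_{12}h(K)P_{21} : K\in S\}$ is convex. The same holds with $L_{2e}$ replaced by $\ell_{2e}$, where $S$ is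 inert with respect to $G$ if for every $K\in S$ the discrete impulse response matrix $(gk)(t)$, $t\in\mathbb{Z}_+$, of $GK$ satisfies $r((gk)(0))<1$, with $r$ the spectral radius. -/

import Mathlib

open MeasureTheory Set
open scoped ENNReal NNReal Topology

noncomputable section

namespace DecControl

/-! ### Notions for general topological vector spaces -/

section General

variable {W U Z Y : Type*}
  [AddCommGroup W] [Module ℝ W] [TopologicalSpace W]
  [AddCommGroup U] [Module ℝ U] [TopologicalSpace U] [IsTopologicalAddGroup U]
  [AddCommGroup Z] [Module ℝ Z] [TopologicalSpace Z] [IsTopologicalAddGroup Z]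
  [AddCommGroup Y] [Module ℝ Y] [TopologicalSpace Y] [IsTopologicalAddGroup Y]

/-- `S` is quadratically invariant under `G`: `K G K ∈ S` for all `K ∈ S`. -/
def QuadraticallyInvariant (S : Set (Y →L[ℝ] U)) (G : U →L[ℝ] Y) : Prop :=
  ∀ K ∈ S, K ∘L G ∘L K ∈ S

/-- `h(K) = -K (I - G K)⁻¹`. The value is meaningful when `I - G K` is invertible in the ring of
continuous linear maps `Y → Y`. -/
def hMap (G : U →L[ℝ] Y) (K : Y →L[ℝ] U) : Y →L[ℝ] U :=
  -(K ∘L Ring.inverse (1 - G ∘L K))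

/-- The set of achievable closed-loop maps `P₁₁ - P₁₂ h(S) P₂₁`. -/
def closedLoopMaps (P₁₁ : W →L[ℝ] Z) (P₁₂ : U →L[ℝ] Z) (P₂₁ : W →L[ℝ] Y) (G : U →L[ℝ] Y)
    (S : Set (Y →L[ℝ] U)) : Set (W →L[ℝ] Z) :=
  (fun Q : Y →L[ℝ] U => P₁₁ - P₁₂ ∘L Q ∘L P₂₁) '' (hMap G '' S)

/-- The operator (extended) norm of `A` from the elements of finite `N`-norm to `Z` with the
(extended) seminorm `q`: the supremum of `q (A f)` over `N f ≤ 1`. -/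
def eOpNorm (N : Y → ℝ≥0∞) (q : U → ℝ≥0∞) (A : Y →L[ℝ] U) : ℝ≥0∞ :=
  ⨆ (f : Y) (_ : N f ≤ 1), q (A f)

/-- The topology on the space of continuous linear maps generated by all open balls for the
operator norms `eOpNorm N (q T)`. -/
@[reducible] def opTopologyOf {ι : Type*} (N : Y → ℝ≥0∞) (q : ι → U → ℝ≥0∞) :
    TopologicalSpace (Y →L[ℝ] U) :=
  TopologicalSpace.generateFrom
    {B | ∃ (T : ι) (A₀ : Y →L[ℝ] U) (r : ℝ),
      B = {A | eOpNorm N (q T) (A - A₀) < ENNReal.ofReal r}}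

end General

/-! ### Continuous time: the extended space `L₂ₑⁿ` -/

/-- Lebesgue measure on the time axis `[0, ∞)`. -/
def timeMeasure : Measure ℝ := volume.restrict (Ici 0)

/-- `P_T f`, on functions. -/
def truncFun {E : Type*} [Zero E] (T : ℝ≥0) (f : ℝ → E) : ℝ → E := (Iic (T : ℝ)).indicator f

/-- `D_T f`, on functions. -/
def shiftFun {E : Type*} [Zero E] (T : ℝ≥0) (f : ℝ → E) : ℝ → E :=
  (Ici (T : ℝ)).indicator fun t => f (t - T)

/-- The (a.e. classes of) measurable functions `f : [0, ∞) → ℝⁿ` with `P_T f ∈ L₂` for all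
`T ≥ 0`, as a subspace of all a.e. classes. -/
def L2eSubmodule (n : ℕ) : Submodule ℝ (ℝ →ₘ[timeMeasure] EuclideanSpace ℝ (Fin n)) where
  carrier := {f | ∀ T : ℝ≥0, MemLp (truncFun T f) 2 timeMeasure}
  zero_mem' := fun T => by
    refine (memLp_congr_ae ?_).mpr (MemLp.zero (ε := EuclideanSpace ℝ (Fin n)))
    filter_upwards [AEEqFun.coeFn_zero (α := ℝ) (μ := timeMeasure)
      (β := EuclideanSpace ℝ (Fin n))] with t ht
    by_cases h : t ∈ Iic (T : ℝ) <;> simp [truncFun, Set.indicator, ht]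
  add_mem' := fun {f g} hf hg T => by
    refine (memLp_congr_ae ?_).mpr ((hf T).add (hg T))
    filter_upwards [AEEqFun.coeFn_add f g] with t ht
    simp only [truncFun, Set.indicator, mem_Iic, Pi.add_apply, ht]
    split_ifs <;> simp
  smul_mem' := fun c f hf T => by
    refine (memLp_congr_ae ?_).mpr ((hf T).const_smul c)
    filter_upwards [AEEqFun.coeFn_smul c f] with t ht
    simp only [truncFun, Set.indicator, mem_Iic, Pi.smul_apply, ht]
    split_ifs <;> simp

/-- The extended space `L₂ₑⁿ`. -/
def L2e (n : ℕ) : Type := L2eSubmodule n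

namespace L2e

variable {m n : ℕ}

instance : AddCommGroup (L2e n) := inferInstanceAs (AddCommGroup (L2eSubmodule n))

instance : Module ℝ (L2e n) := inferInstanceAs (Module ℝ (L2eSubmodule n))

/-- A representative of an element of `L₂ₑⁿ`; only its values on `[0, ∞)`, up to null sets,
carry information. -/
def toFun (f : L2e n) : ℝ → EuclideanSpace ℝ (Fin n) := (f.1 : ℝ → EuclideanSpace ℝ (Fin n))

/-- The class in `L₂ₑⁿ` of a function. -/
def mk (f : ℝ → EuclideanSpace ℝ (Fin n)) (hf : AEStronglyMeasurable f timeMeasure)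
    (h : ∀ T : ℝ≥0, MemLp (truncFun T f) 2 timeMeasure) : L2e n :=
  ⟨AEEqFun.mk f hf, fun T => by
    refine (memLp_congr_ae ?_).mpr (h T)
    filter_upwards [AEEqFun.coeFn_mk f hf] with t ht
    simp only [truncFun, Set.indicator, mem_Iic, ht]⟩

/-- The extended norm of `L₂`, infinite outside of `L₂`. -/
def eNorm (f : L2e n) : ℝ≥0∞ := eLpNorm f.toFun 2 timeMeasure

/-- `‖f‖_T = ‖P_T f‖_{L₂}`. -/
def eNormT (T : ℝ≥0) (f : L2e n) : ℝ≥0∞ := eLpNorm (truncFun T f.toFun) 2 timeMeasure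

theorem memLp_trunc (f : L2e n) (T : ℝ≥0) : MemLp (truncFun T f.toFun) 2 timeMeasure := f.2 T

theorem stronglyMeasurable (f : L2e n) : StronglyMeasurable f.toFun :=
  AEEqFun.stronglyMeasurable _

theorem toFun_add (f g : L2e n) : (f + g).toFun =ᵐ[timeMeasure] f.toFun + g.toFun :=
  AEEqFun.coeFn_add f.1 g.1

theorem toFun_smul (c : ℝ) (f : L2e n) : (c • f).toFun =ᵐ[timeMeasure] c • f.toFun :=
  AEEqFun.coeFn_smul c f.1

/-- `‖·‖_T` as a seminorm. -/
def seminormT (n : ℕ) : SeminormFamily ℝ (L2e n) ℝ≥0 := fun T =>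
  Seminorm.of (fun f => (eNormT T f).toReal)
    (fun f g => by
      have h : eNormT T (f + g) ≤ eNormT T f + eNormT T g := by
        refine le_trans (le_of_eq (eLpNorm_congr_ae ?_))
          (eLpNorm_add_le (f.memLp_trunc T).1 (g.memLp_trunc T).1 (by norm_num))
        filter_upwards [toFun_add f g] with t ht
        simp only [truncFun, Set.indicator, mem_Iic, Pi.add_apply, ht]
        split_ifs <;> simp
      refine le_of_le_of_eq ?_
        (ENNReal.toReal_add (f.memLp_trunc T).2.ne (g.memLp_trunc T).2.ne)
      exact ENNReal.toReal_mono
        (ENNReal.add_ne_top.mpr ⟨(f.memLp_trunc T).2.ne, (g.memLp_trunc T).2.ne⟩) h)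
    (fun c f => by
      have h : eNormT T (c • f) = ‖c‖ₑ * eNormT T f := by
        refine (eLpNorm_congr_ae ?_).trans (eLpNorm_const_smul c _ 2 timeMeasure)
        filter_upwards [toFun_smul c f] with t ht
        simp only [truncFun, Set.indicator, mem_Iic, Pi.smul_apply, ht]
        split_ifs <;> simp
      rw [h, ENNReal.toReal_mul, toReal_enorm])

/-- The topology of `L₂ₑⁿ`, generated by the open `‖·‖_T`-balls. -/
instance : TopologicalSpace (L2e n) := (seminormT n).moduleFilterBasis.topology

theorem withSeminorms (n : ℕ) : WithSeminorms (seminormT n) := ⟨rfl⟩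

instance : IsTopologicalAddGroup (L2e n) := (withSeminorms n).topologicalAddGroup

instance : ContinuousSMul ℝ (L2e n) := (withSeminorms n).continuousSMul

/-- The truncation `P_T` on `L₂ₑⁿ`. -/
def trunc (T : ℝ≥0) (f : L2e n) : L2e n :=
  mk (truncFun T f.toFun) (f.memLp_trunc T).1 fun _ =>
    (f.memLp_trunc T).indicator measurableSet_Iic

/-- The shift `D_T` on `L₂ₑⁿ`. -/
def shift (T : ℝ≥0) (f : L2e n) : L2e n :=
  mk (shiftFun T f.toFun)
    ((f.stronglyMeasurable.comp_measurable (measurable_sub_const (T : ℝ))).indicator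
      measurableSet_Ici).aestronglyMeasurable
    (fun T' => by
      have hmp : MeasurePreserving (fun t : ℝ => t - (T : ℝ)) volume volume :=
        measurePreserving_sub_right volume (T : ℝ)
      have h0 := f.memLp_trunc T'
      unfold timeMeasure at h0 ⊢
      rw [← memLp_indicator_iff_restrict measurableSet_Ici] at h0 ⊢
      have h1 := (h0.comp_measurePreserving hmp).indicator
        (measurableSet_Iic (a := (T' : ℝ)))
      convert h1 using 1
      funext t
      have hT : (0 : ℝ) ≤ T := T.2
      have hT' : (0 : ℝ) ≤ T' := T'.2
      simp only [truncFun, shiftFun, Set.indicator, mem_Ici, mem_Iic, Function.comp_apply]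
      split_ifs <;> first | rfl | (exfalso; linarith))

/-- `A` is causal: `P_T A P_T = P_T A` for all `T ≥ 0`. -/
def IsCausal (A : L2e m →L[ℝ] L2e n) : Prop :=
  ∀ (T : ℝ≥0) (f : L2e m), trunc T (A (trunc T f)) = trunc T (A f)

/-- `A` is time-invariant: `D_T A = A D_T` for all `T > 0`. -/
def IsTimeInvariant (A : L2e m →L[ℝ] L2e n) : Prop :=
  ∀ (T : ℝ≥0) (f : L2e m), 0 < T → shift T (A f) = A (shift T f)

/-- The set of continuous linear causal time-invariant maps. -/
def LTI (m n : ℕ) : Set (L2e m →L[ℝ] L2e n) := {A | IsCausal A ∧ IsTimeInvariant A}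

/-- The topology on `𝓛(L₂ₑᵐ, L₂ₑⁿ)` generated by the open balls for
`‖A‖_T = ‖P_T A‖_{L₂ → L₂}`. -/
@[reducible] def opTopology (m n : ℕ) : TopologicalSpace (L2e m →L[ℝ] L2e n) :=
  opTopologyOf (eNorm : L2e m → ℝ≥0∞) (fun T => (eNormT T : L2e n → ℝ≥0∞))

/-- `A` is convolution with the matrix-valued function `a`, all of whose entries are in
`L_∞ₑ`; that is, the impulse response matrix of `A` is `a`. -/
def HasBoundedImpulseResponse (A : L2e m →L[ℝ] L2e n) (a : ℝ → Matrix (Fin n) (Fin m) ℝ) :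
    Prop :=
  (∀ i j, ∀ T : ℝ≥0, MemLp (truncFun T fun t => a t i j) ∞ timeMeasure) ∧
  ∀ f : L2e m, ∀ᵐ t ∂timeMeasure, ∀ i,
    (A f).toFun t i = ∑ j, ∫ s in (0 : ℝ)..t, a (t - s) i j * f.toFun s j

/-- `S` is inert with respect to `G`: for all `K ∈ S` the impulse response matrix of `G K` has
all its entries in `L_∞ₑ`. -/
def IsInert {ny nu : ℕ} (S : Set (L2e ny →L[ℝ] L2e nu)) (G : L2e nu →L[ℝ] L2e ny) : Prop :=
  ∀ K ∈ S, ∃ a, HasBoundedImpulseResponse (G ∘L K) a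

end L2e

/-! ### Discrete time: the extended space `ℓ₂ₑⁿ` -/

/-- The extended space `ℓ₂ₑⁿ` of all sequences in `ℝⁿ`. Its topology is the product topology, which
is the one generated by the truncated `ℓ₂`-norms (see `ell2e.withSeminorms`). -/
abbrev ell2e (n : ℕ) : Type := ℕ → EuclideanSpace ℝ (Fin n)

namespace ell2e

variable {m n : ℕ}

/-- The truncation `P_T`. -/
def trunc (T : ℕ) (f : ell2e n) : ell2e n := fun t => if t ≤ T then f t else 0

/-- The shift `D_T`. -/
def shift (T : ℕ) (f : ell2e n) : ell2e n := fun t => if t < T then 0 else f (t - T)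

/-- The extended norm of `ℓ₂`, infinite outside of `ℓ₂`. -/
def eNorm (f : ell2e n) : ℝ≥0∞ := (∑' t, ‖f t‖ₑ ^ 2) ^ (1 / 2 : ℝ)

/-- `‖f‖_T = ‖P_T f‖_{ℓ₂}`. -/
def eNormT (T : ℕ) (f : ell2e n) : ℝ≥0∞ := eNorm (trunc T f)

/-- `‖·‖_T` as a seminorm. -/
def seminormT (n : ℕ) : SeminormFamily ℝ (ell2e n) ℕ := fun T =>
  (normSeminorm ℝ (PiLp 2 fun _ : Fin (T + 1) => EuclideanSpace ℝ (Fin n))).comp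
    ((WithLp.linearEquiv 2 ℝ (Fin (T + 1) → EuclideanSpace ℝ (Fin n))).symm.toLinearMap ∘ₗ
      LinearMap.funLeft ℝ (EuclideanSpace ℝ (Fin n)) (fun t : Fin (T + 1) => (t : ℕ)))

theorem seminormT_eq (T : ℕ) (f : ell2e n) : seminormT n T f = (eNormT T f).toReal := by
  have h1 : ∑' t, ‖trunc T f t‖ₑ ^ 2 = ∑ t ∈ Finset.range (T + 1), ‖f t‖ₑ ^ 2 := by
    rw [tsum_eq_sum (s := Finset.range (T + 1))]
    · refine Finset.sum_congr rfl fun t ht => ?_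
      rw [trunc, if_pos (by simpa [Nat.lt_succ_iff] using ht)]
    · intro t ht
      rw [trunc, if_neg (by simpa [Nat.lt_succ_iff] using ht)]
      simp
  rw [eNormT, eNorm, h1, ← ENNReal.toReal_rpow, ENNReal.toReal_sum (by simp),
    ← Real.sqrt_eq_rpow, Finset.sum_range]
  simp [seminormT, PiLp.norm_eq_of_L2, LinearMap.funLeft_apply]

/-- The topology of `ℓ₂ₑⁿ` is generated by the open `‖·‖_T`-balls. -/
theorem withSeminorms (n : ℕ) : WithSeminorms (seminormT n) := by
  refine WithSeminorms.congr (withSeminorms_pi fun _ : ℕ =>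
    norm_withSeminorms ℝ (EuclideanSpace ℝ (Fin n))) ?_ ?_
  · intro T
    refine ⟨(Finset.range (T + 1)).map ⟨fun t => ⟨t, 0⟩, fun a b hab => by simpa using hab⟩,
      (T : ℝ≥0) + 1, fun f => ?_⟩
    set q := ((Finset.range (T + 1)).map
      (⟨fun t => ⟨t, 0⟩, fun a b hab => by simpa using hab⟩ : ℕ ↪ (_ : ℕ) × Fin 1)).sup
      (SeminormFamily.sigma fun i => SeminormFamily.comp
        (fun _ : Fin 1 => normSeminorm ℝ (EuclideanSpace ℝ (Fin n)))
        (LinearMap.proj (R := ℝ) (φ := fun _ : ℕ => EuclideanSpace ℝ (Fin n)) i)) with hq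
    have hle : ∀ t : Fin (T + 1), ‖f t‖ ≤ q f := fun t => by
      have h := Finset.le_sup (f := SeminormFamily.sigma fun i => SeminormFamily.comp
        (fun _ : Fin 1 => normSeminorm ℝ (EuclideanSpace ℝ (Fin n)))
        (LinearMap.proj (R := ℝ) (φ := fun _ : ℕ => EuclideanSpace ℝ (Fin n)) i))
        (Finset.mem_map_of_mem
          (⟨fun t => ⟨t, 0⟩, fun a b hab => by simpa using hab⟩ : ℕ ↪ (_ : ℕ) × Fin 1)
          (Finset.mem_range.mpr t.2))
      exact h f
    have h1 : seminormT n T f = √(∑ t : Fin (T + 1), ‖f t‖ ^ 2) := by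
      simp [seminormT, PiLp.norm_eq_of_L2, LinearMap.funLeft_apply]
    have h2 : ∑ t : Fin (T + 1), ‖f t‖ ^ 2 ≤ ((T : ℝ) + 1) * q f ^ 2 := by
      refine (Finset.sum_le_card_nsmul _ _ (q f ^ 2) fun t _ => ?_).trans_eq (by simp)
      exact pow_le_pow_left₀ (norm_nonneg _) (hle t) 2
    change seminormT n T f ≤ ((T : ℝ) + 1) * q f
    have hq0 : 0 ≤ q f := apply_nonneg q f
    have hT : (0 : ℝ) ≤ T := T.cast_nonneg
    rw [h1]
    refine Real.sqrt_le_iff.mpr ⟨by positivity, h2.trans ?_⟩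
    nlinarith [mul_nonneg (mul_nonneg hT (sq_nonneg (q f))) (by positivity : (0 : ℝ) ≤ T + 1)]
  · rintro ⟨t, i⟩
    refine ⟨{t}, 1, fun f => ?_⟩
    rw [Finset.sup_singleton, one_smul]
    exact PiLp.norm_apply_le (p := 2)
      (WithLp.toLp 2 fun s : Fin (t + 1) => f s) (Fin.last t)

/-- `A` is causal: `P_T A P_T = P_T A` for all `T ≥ 0`. -/
def IsCausal (A : ell2e m →L[ℝ] ell2e n) : Prop :=
  ∀ (T : ℕ) (f : ell2e m), trunc T (A (trunc T f)) = trunc T (A f)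

/-- `A` is time-invariant: `D_T A = A D_T` for all `T > 0`. -/
def IsTimeInvariant (A : ell2e m →L[ℝ] ell2e n) : Prop :=
  ∀ (T : ℕ) (f : ell2e m), 0 < T → shift T (A f) = A (shift T f)

/-- The set of continuous linear causal time-invariant maps. -/
def LTI (m n : ℕ) : Set (ell2e m →L[ℝ] ell2e n) := {A | IsCausal A ∧ IsTimeInvariant A}

/-- The topology on `𝓛(ℓ₂ₑᵐ, ℓ₂ₑⁿ)` generated by the open balls for
`‖A‖_T = ‖P_T A‖_{ℓ₂ → ℓ₂}`. -/
@[reducible] def opTopology (m n : ℕ) : TopologicalSpace (ell2e m →L[ℝ] ell2e n) :=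
  opTopologyOf (eNorm : ell2e m → ℝ≥0∞) (fun T => (eNormT T : ell2e n → ℝ≥0∞))

/-- The discrete impulse response matrix of `A` at time `t`: its `j`-th column is the value at
time `t` of the response of `A` to the unit impulse at time `0` in the `j`-th input. -/
def impulseResponse (A : ell2e m →L[ℝ] ell2e n) (t : ℕ) : Matrix (Fin n) (Fin m) ℝ :=
  Matrix.of fun i j => A (Pi.single 0 (EuclideanSpace.single j 1)) t i

/-- `S` is inert with respect to `G`: for all `K ∈ S` the impulse response matrix of `G K` at time
`0` has spectral radius (over `ℂ`) less than `1`. That its entries are in `ℓₑ` is automatic, as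
`ℓₑ` consists of all real sequences. -/
def IsInert {ny nu : ℕ} (S : Set (ell2e ny →L[ℝ] ell2e nu)) (G : ell2e nu →L[ℝ] ell2e ny) : Prop :=
  ∀ K ∈ S, spectralRadius ℂ ((impulseResponse (G ∘L K) 0).map Complex.ofReal) < 1

end ell2e

end DecControl

end

open DecControl

/-! The map `h` is an involution, because `1 - G h(K)` is the inverse of `1 - GK`. If `S` is
quadratically invariant, polarising `K ↦ KGK` puts every `K(GK)^n` in `S`; the Neumann series of `(1
- GK)⁻¹` and closedness then give `h(S) ⊆ S`, hence `h(S) = S`. The closed-loop set is thus an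
affine image of a subspace, so convex.

Conversely, `h(0) = 0`, so convexity and cancellation of `P₁₂` and `P₂₁` by their one-sided inverses
give `α h(K) ∈ h(S)` for `0 < α < 1`. Solving `h(K') = α h(K)` yields `K' = (1 - β) K (1 - βGK)⁻¹`
with `β = 1 - α`. Dividing `K' / (1 - β) - K` by `β` shows that `K GK (1 - βGK)⁻¹` lies in `S`; as
`β → 0` this tends to `KGK`.

Both directions need only `PowersSummable`: in each seminorm the powers of `GK` have summable
bounds. This is where inertness enters. In continuous time a locally bounded kernel makes `GK` a
Volterra operator, whose powers decay factorially. In discrete time the spectral radius condition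
makes a power of `GK` contract at time zero, and a norm that discounts later times extends the
contraction to each finite horizon. -/

noncomputable section

namespace DecControl

open Filter

/-! ### Neumann series in a space with a family of seminorms -/

section Resolvent

variable {ι : Type*} {Y : Type*} [AddCommGroup Y] [Module ℝ Y] [TopologicalSpace Y]
  [IsTopologicalAddGroup Y]

/-- The powers of `A` are summable for each of the seminorms `p T`. -/
def PowersSummable (p : SeminormFamily ℝ Y ι) (A : Y →L[ℝ] Y) : Prop :=
  ∀ T, ∃ c : ℕ → ℝ, (∀ n, 0 ≤ c n) ∧ Summable c ∧ ∀ n f, p T ((A ^ n) f) ≤ c n * p T f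

/-- Every series that converges absolutely for each of the seminorms converges. -/
def SeriesComplete (p : SeminormFamily ℝ Y ι) : Prop :=
  ∀ u : ℕ → Y, (∀ T, Summable fun n => p T (u n)) →
    ∃ f, ∀ T, Tendsto (fun n => p T (f - ∑ k ∈ Finset.range n, u k)) atTop (𝓝 0)

/-- The seminorms separate points. -/
def Separates (p : SeminormFamily ℝ Y ι) : Prop := ∀ f, (∀ T, p T f = 0) → f = 0

/-- Telescoping gives `f = ∑_{k<n} A^k (1 - A) f + A^n f`, and the remainder vanishes in the limit.
This a priori estimate yields injectivity of `1 - A` and continuity of its inverse, without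
completeness. -/
theorem le_tsum_mul_of_powers {p : Seminorm ℝ Y} {A : Y →L[ℝ] Y} {c : ℕ → ℝ}
    (hc0 : ∀ n, 0 ≤ c n) (hc : Summable c) (h : ∀ n f, p ((A ^ n) f) ≤ c n * p f) (f : Y) :
    p f ≤ (∑' n, c n) * p ((1 - A) f) := by
  have key : ∀ n, p f ≤ (∑' n, c n) * p ((1 - A) f) + c n * p f := by
    intro n
    have h1 : f = (∑ k ∈ Finset.range n, (A ^ k) ((1 - A) f)) + (A ^ n) f := by
      have h2 := congrArg (fun B : Y →L[ℝ] Y => B f) (geom_sum_mul_neg A n)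
      have h3 : (∑ k ∈ Finset.range n, (A ^ k) ((1 - A) f)) = f - (A ^ n) f := by
        rw [← sum_apply]
        exact h2
      rw [h3, sub_add_cancel]
    calc p f = p ((∑ k ∈ Finset.range n, (A ^ k) ((1 - A) f)) + (A ^ n) f) := by rw [← h1]
      _ ≤ p (∑ k ∈ Finset.range n, (A ^ k) ((1 - A) f)) + p ((A ^ n) f) := map_add_le_add p _ _
      _ ≤ (∑ k ∈ Finset.range n, p ((A ^ k) ((1 - A) f))) + c n * p f :=
          add_le_add (Finset.le_sum_of_subadditive p (map_zero p).le (map_add_le_add p) _ _) (h n f)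
      _ ≤ (∑ k ∈ Finset.range n, c k * p ((1 - A) f)) + c n * p f := by
          gcongr with k _
          exact h k _
      _ ≤ (∑' n, c n) * p ((1 - A) f) + c n * p f := by
          rw [← Finset.sum_mul]
          gcongr
          exact hc.sum_le_tsum _ fun i _ => hc0 i
  have hlim : Tendsto (fun n => (∑' n, c n) * p ((1 - A) f) + c n * p f) atTop
      (𝓝 ((∑' n, c n) * p ((1 - A) f) + 0 * p f)) :=
    tendsto_const_nhds.add (hc.tendsto_atTop_zero.mul_const _)
  rw [zero_mul, add_zero] at hlim
  exact ge_of_tendsto' hlim key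

/-- The constants `c` do not depend on `β`, so the resolvents `(1 - βA)⁻¹` are bounded uniformly as
`β → 0`. -/
theorem powers_smul_le {p : Seminorm ℝ Y} [ContinuousConstSMul ℝ Y] {A : Y →L[ℝ] Y} {c : ℕ → ℝ}
    (h : ∀ n f, p ((A ^ n) f) ≤ c n * p f)
    {β : ℝ} (h0 : 0 ≤ β) (h1 : β ≤ 1) (n : ℕ) (f : Y) : p (((β • A) ^ n) f) ≤ c n * p f := by
  rw [smul_pow, smul_apply, map_smul_eq_mul, Real.norm_of_nonneg (by positivity)]
  exact (mul_le_of_le_one_left (apply_nonneg _ _) (pow_le_one₀ h0 h1)).trans (h n f)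

theorem PowersSummable.smul [ContinuousConstSMul ℝ Y] {p : SeminormFamily ℝ Y ι} {A : Y →L[ℝ] Y}
    (h : PowersSummable p A) {β : ℝ} (h0 : 0 ≤ β) (h1 : β ≤ 1) : PowersSummable p (β • A) :=
  fun T => by
    obtain ⟨c, hc0, hc, h⟩ := h T
    exact ⟨c, hc0, hc, powers_smul_le h h0 h1⟩

theorem PowersSummable.isUnit_one_sub {p : SeminormFamily ℝ Y ι} (hp : WithSeminorms p)
    (hcomp : SeriesComplete p) (hsep : Separates p) {A : Y →L[ℝ] Y} (h : PowersSummable p A) :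
    IsUnit (1 - A) := by
  choose c hc0 hc h using h
  have hbound : ∀ T f, p T f ≤ (∑' n, c T n) * p T ((1 - A) f) := fun T f =>
    le_tsum_mul_of_powers (hc0 T) (hc T) (h T) f
  have hinj : Function.Injective (1 - A : Y →L[ℝ] Y) := by
    refine (injective_iff_map_eq_zero _).mpr fun f hf => hsep f fun T => ?_
    refine le_antisymm ?_ (apply_nonneg _ _)
    simpa [hf] using hbound T f
  have hsurj : Function.Surjective (1 - A : Y →L[ℝ] Y) := by
    intro g
    obtain ⟨f, hf⟩ := hcomp (fun n => (A ^ n) g) fun T =>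
      Summable.of_nonneg_of_le (fun n => apply_nonneg _ _) (fun n => h T n g)
        ((hc T).mul_right _)
    refine ⟨f, sub_eq_zero.mp (hsep _ fun T => le_antisymm ?_ (apply_nonneg _ _))⟩
    -- With `s` the partial sum, `(1 - A) f - g = (1 - A)(f - s) - A^n g`. The case `n = 1` of the
    -- power bound controls `A` by the same seminorm `p T`.
    have key : ∀ n, p T ((1 - A) f - g) ≤
        (1 + c T 1) * p T (f - ∑ k ∈ Finset.range n, (A ^ k) g) + c T n * p T g := by
      intro n
      set s := ∑ k ∈ Finset.range n, (A ^ k) g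
      have h2 : (1 - A) s = g - (A ^ n) g := by
        have h3 := congrArg (fun B : Y →L[ℝ] Y => B g) (mul_neg_geom_sum A n)
        have h10 : s = (∑ k ∈ Finset.range n, A ^ k) g := by rw [sum_apply]
        rw [h10]
        exact h3
      have h4 : (1 - A) f - g = (f - s) - A (f - s) - (A ^ n) g := by
        have h5 : (1 - A) f = (1 - A) (f - s) + (g - (A ^ n) g) := by
          rw [← h2, ← map_add, sub_add_cancel]
        rw [h5, sub_apply, one_apply_eq_self]
        abel
      rw [h4]
      have h6 := map_sub_le_add (p T) ((f - s) - A (f - s)) ((A ^ n) g)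
      have h7 := map_sub_le_add (p T) (f - s) (A (f - s))
      have h8 := h T 1 (f - s)
      rw [pow_one] at h8
      have h9 := h T n g
      linarith
    have hlim := ((hf T).const_mul (1 + c T 1)).add ((hc T).tendsto_atTop_zero.mul_const (p T g))
    simp only [mul_zero, zero_mul, add_zero] at hlim
    exact ge_of_tendsto' hlim key
  let e := LinearEquiv.ofBijective ((1 - A : Y →L[ℝ] Y) : Y →ₗ[ℝ] Y) ⟨hinj, hsurj⟩
  have he : ∀ f, (1 - A) (e.symm f) = f := fun f => e.apply_symm_apply f
  have hcont : Continuous (e.symm : Y →ₗ[ℝ] Y) := by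
    refine hp.continuous_of_isBounded hp _ fun T => ⟨{T}, Real.toNNReal (∑' n, c T n), fun f => ?_⟩
    have h1 := hbound T (e.symm f)
    rw [he] at h1
    simpa [Finset.sup_singleton, NNReal.smul_def,
      Real.coe_toNNReal _ (tsum_nonneg (hc0 T))] using h1
  refine ⟨⟨1 - A, ⟨(e.symm : Y →ₗ[ℝ] Y), hcont⟩, ?_, ?_⟩, rfl⟩
  · ext f
    exact he f
  · ext f
    exact e.symm_apply_apply f

end Resolvent

/-! ### Closed subspaces of operators and the map `h` -/

section QI

variable {ι κ : Type*} {W U Z Y : Type*}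
  [AddCommGroup W] [Module ℝ W] [TopologicalSpace W]
  [AddCommGroup U] [Module ℝ U] [TopologicalSpace U] [IsTopologicalAddGroup U]
  [AddCommGroup Z] [Module ℝ Z] [TopologicalSpace Z] [IsTopologicalAddGroup Z]
  [AddCommGroup Y] [Module ℝ Y] [TopologicalSpace Y] [IsTopologicalAddGroup Y]

omit [IsTopologicalAddGroup Y] in
-- The generating balls have arbitrary centres `A₀`, so convergence is tested on every ball
-- containing `B₀`; the triangle inequality and the strict inequality defining the ball leave enough
-- room.
theorem mem_of_eOpNorm_tendsto {N : Y → ℝ≥0∞} {q : κ → Seminorm ℝ U} {S : Set (Y →L[ℝ] U)}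
    (hS : IsClosed[opTopologyOf N fun T f => ENNReal.ofReal (q T f)] S)
    {B : ℕ → Y →L[ℝ] U} {B₀ : Y →L[ℝ] U} (hB : ∀ n, B n ∈ S)
    (h : ∀ T, ∃ d : ℕ → ℝ, Tendsto d atTop (𝓝 0) ∧
      ∀ n f, N f ≤ 1 → q T ((B n - B₀) f) ≤ d n) : B₀ ∈ S := by
  have hlim : @Tendsto _ _ B atTop
      (@nhds _ (opTopologyOf N fun T f => ENNReal.ofReal (q T f)) B₀) := by
    rw [TopologicalSpace.tendsto_nhds_generateFrom_iff]
    rintro _ ⟨T, A₀, r, rfl⟩ hr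
    obtain ⟨d, hd, hdB⟩ := h T
    have hr' : eOpNorm N (fun f => ENNReal.ofReal (q T f)) (B₀ - A₀) < ENNReal.ofReal r := hr
    have hlim2 : Tendsto (fun n => ENNReal.ofReal (d n) +
        eOpNorm N (fun f => ENNReal.ofReal (q T f)) (B₀ - A₀)) atTop
        (𝓝 (ENNReal.ofReal 0 + eOpNorm N (fun f => ENNReal.ofReal (q T f)) (B₀ - A₀))) :=
      (ENNReal.tendsto_ofReal hd).add tendsto_const_nhds
    rw [ENNReal.ofReal_zero, zero_add] at hlim2
    filter_upwards [hlim2.eventually_lt_const hr'] with n hn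
    refine lt_of_le_of_lt ?_ hn
    refine iSup₂_le fun f hf => ?_
    have h1 : (B n - A₀) f = (B n - B₀) f + (B₀ - A₀) f := by
      simp
    calc ENNReal.ofReal (q T ((B n - A₀) f))
        ≤ ENNReal.ofReal (q T ((B n - B₀) f) + q T ((B₀ - A₀) f)) := by
          rw [h1]
          exact ENNReal.ofReal_le_ofReal (map_add_le_add _ _ _)
      _ ≤ ENNReal.ofReal (q T ((B n - B₀) f)) + ENNReal.ofReal (q T ((B₀ - A₀) f)) :=
          ENNReal.ofReal_add_le
      _ ≤ _ := add_le_add (ENNReal.ofReal_le_ofReal (hdB n f hf))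
          (le_iSup₂ (f := fun f (_ : N f ≤ 1) => ENNReal.ofReal (q T ((B₀ - A₀) f))) f hf)
  exact @IsClosed.mem_of_tendsto _ (opTopologyOf N fun T f => ENNReal.ofReal (q T f)) _
    _ _ _ _ _ hS hlim (Eventually.of_forall hB)

omit [IsTopologicalAddGroup U] [IsTopologicalAddGroup Y] in
theorem exists_bound_of_withSeminorms {p : SeminormFamily ℝ Y ι} {q : SeminormFamily ℝ U κ}
    (hp : WithSeminorms p) (hq : WithSeminorms q) (B : Y →L[ℝ] U) (T : κ) :
    ∃ (s : Finset ι) (C : ℝ), 0 ≤ C ∧ ∀ f, q T (B f) ≤ C * ∑ i ∈ s, p i f := by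
  obtain ⟨s, C, -, h⟩ := Seminorm.bound_of_continuous hp ((q T).comp (B : Y →ₗ[ℝ] U))
    ((hq.continuous_seminorm T).comp B.continuous)
  refine ⟨s, C, C.2, fun f => (h f).trans ?_⟩
  rw [smul_apply, NNReal.smul_def, smul_eq_mul]
  gcongr
  refine (Seminorm.finset_sup_le_sum p s f).trans (le_of_eq ?_)
  simp [sum_apply]

theorem comp_hMap {G : U →L[ℝ] Y} {K : Y →L[ℝ] U} (hu : IsUnit (1 - G ∘L K)) :
    G ∘L hMap G K = 1 - Ring.inverse (1 - G ∘L K) := by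
  have hR : (1 - G ∘L K) * Ring.inverse (1 - G ∘L K) = 1 := Ring.mul_inverse_cancel _ hu
  have h1 : G ∘L hMap G K = -((G ∘L K) * Ring.inverse (1 - G ∘L K)) := by
    rw [hMap, ContinuousLinearMap.comp_neg]
    rfl
  rw [sub_mul, one_mul] at hR
  rw [h1, eq_sub_iff_add_eq, neg_add_eq_sub, hR]

/-- By `comp_hMap`, the resolvent formed from `h(K)` is `1 - GK` itself, which cancels the one in
`h(K)`. -/
theorem hMap_hMap {G : U →L[ℝ] Y} {K : Y →L[ℝ] U} (hu : IsUnit (1 - G ∘L K)) :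
    hMap G (hMap G K) = K := by
  have h1 : 1 - G ∘L hMap G K = Ring.inverse (1 - G ∘L K) := by
    rw [comp_hMap hu, sub_sub_cancel]
  have h2 : Ring.inverse (Ring.inverse (1 - G ∘L K)) = 1 - G ∘L K := by
    obtain ⟨v, hv⟩ := hu
    rw [← hv, Ring.inverse_unit, Ring.inverse_unit, inv_inv]
  have hR : Ring.inverse (1 - G ∘L K) * (1 - G ∘L K) = 1 := Ring.inverse_mul_cancel _ hu
  rw [hMap, h1, h2]
  rw [hMap, ContinuousLinearMap.neg_comp, neg_neg, ContinuousLinearMap.comp_assoc]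
  change K ∘L (Ring.inverse (1 - G ∘L K) * (1 - G ∘L K)) = K
  rw [hR]
  rfl

omit [IsTopologicalAddGroup U] [IsTopologicalAddGroup Y] in
/-- Composition with a fixed continuous linear map preserves convergence to zero in operator
seminorm. -/
theorem exists_tendsto_bound {p : SeminormFamily ℝ Y ι} {q : SeminormFamily ℝ U κ}
    (hp : WithSeminorms p) (hq : WithSeminorms q) {N : Y → ℝ≥0∞}
    (hN : ∀ T f, N f ≤ 1 → p T f ≤ 1) {α : ℕ → Y →L[ℝ] Y} (B : Y →L[ℝ] U)
    (h : ∀ T, ∃ c : ℕ → ℝ, Tendsto c atTop (𝓝 0) ∧ ∀ n f, p T f ≤ 1 → p T (α n f) ≤ c n) (T : κ) :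
    ∃ d : ℕ → ℝ, Tendsto d atTop (𝓝 0) ∧ ∀ n f, N f ≤ 1 → q T ((B ∘L α n) f) ≤ d n := by
  obtain ⟨s, C, hC, hB⟩ := exists_bound_of_withSeminorms hp hq B T
  choose c hc h using h
  refine ⟨fun n => C * ∑ i ∈ s, c i n, ?_, fun n f hf => ?_⟩
  · have := (tendsto_finsetSum s fun i _ => hc i).const_mul C
    simpa using this
  · refine (hB _).trans ?_
    exact mul_le_mul_of_nonneg_left (Finset.sum_le_sum fun i _ => h i n f (hN i f hf)) hC

/-! ### Quadratic invariance implies that `h` preserves `S` -/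

variable [ContinuousConstSMul ℝ U]

/-- Polarisation at `K` and `K' = K(GK)^n`: both cross terms `KGK'` and `K'GK` equal `K(GK)^(n+1)`,
so twice this operator lies in `S`. -/
theorem comp_pow_mem_of_quadraticallyInvariant {S : Submodule ℝ (Y →L[ℝ] U)} {G : U →L[ℝ] Y}
    (hQI : QuadraticallyInvariant (S : Set (Y →L[ℝ] U)) G) {K : Y →L[ℝ] U} (hK : K ∈ S) (n : ℕ) :
    K ∘L (G ∘L K) ^ n ∈ S := by
  induction n with
  | zero => simpa [ContinuousLinearMap.one_def] using hK
  | succ n ih =>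
    set K' := K ∘L (G ∘L K) ^ n with hK'
    have h1 := hQI (K + K') (S.add_mem hK ih)
    have h2 := hQI K hK
    have h3 := hQI K' ih
    have e1 : K ∘L G ∘L K' = K ∘L (G ∘L K) ^ (n + 1) := by
      rw [pow_succ']
      rfl
    have e2 : K' ∘L G ∘L K = K ∘L (G ∘L K) ^ (n + 1) := by
      rw [pow_succ]
      rfl
    have e3 : (K + K') ∘L G ∘L (K + K') = K ∘L G ∘L K + K' ∘L G ∘L K' +
        (2 : ℝ) • (K ∘L (G ∘L K) ^ (n + 1)) := by
      rw [two_smul]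
      nth_rewrite 1 [← e1]
      rw [← e2]
      simp only [ContinuousLinearMap.comp_add, ContinuousLinearMap.add_comp]
      abel
    rw [SetLike.mem_coe, e3] at h1
    have h4 := S.sub_mem h1 (S.add_mem h2 h3)
    rw [add_sub_cancel_left] at h4
    exact (S.smul_mem_iff two_ne_zero).mp h4

/-- The partial sums `∑_{k<n} K A^k`, with `A = GK`, lie in `S` and differ from `K(1 - A)⁻¹` by `K
A^n (1 - A)⁻¹`, which tends to zero in each operator seminorm. -/
theorem hMap_mem_of_quadraticallyInvariant {p : SeminormFamily ℝ Y ι} {q : SeminormFamily ℝ U κ}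
    (hp : WithSeminorms p) (hq : WithSeminorms q)
    (hcomp : SeriesComplete p) (hsep : Separates p) {N : Y → ℝ≥0∞}
    (hN : ∀ T f, N f ≤ 1 → p T f ≤ 1) {S : Submodule ℝ (Y →L[ℝ] U)} {G : U →L[ℝ] Y}
    (hS : IsClosed[opTopologyOf N fun T f => ENNReal.ofReal (q T f)] (S : Set (Y →L[ℝ] U)))
    (hQI : QuadraticallyInvariant (S : Set (Y →L[ℝ] U)) G) {K : Y →L[ℝ] U} (hK : K ∈ S)
    (hA : PowersSummable p (G ∘L K)) : hMap G K ∈ S := by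
  have hu := hA.isUnit_one_sub hp hcomp hsep
  set A := G ∘L K
  have hR : (1 - A) * Ring.inverse (1 - A) = 1 := Ring.mul_inverse_cancel _ hu
  refine S.neg_mem ?_
  change K ∘L Ring.inverse (1 - A) ∈ S
  set R := Ring.inverse (1 - A)
  refine mem_of_eOpNorm_tendsto hS (B := fun n => ∑ k ∈ Finset.range n, K ∘L A ^ k)
    (fun n => S.sum_mem fun k _ => comp_pow_mem_of_quadraticallyInvariant hQI hK k) fun T => ?_
  have h1 : ∀ T, ∃ c : ℕ → ℝ, Tendsto c atTop (𝓝 0) ∧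
      ∀ n f, p T f ≤ 1 → p T ((A ^ n * R) f) ≤ c n := by
    intro T
    obtain ⟨c, hc0, hc, h⟩ := hA T
    refine ⟨fun n => c n * ((∑' n, c n) * 1), ?_, fun n f hf => (h n _).trans ?_⟩
    · simpa using hc.tendsto_atTop_zero.mul_const ((∑' n, c n) * 1)
    · refine mul_le_mul_of_nonneg_left ?_ (hc0 n)
      refine (le_tsum_mul_of_powers hc0 hc h (R f)).trans ?_
      have : (1 - A) (R f) = f := congrArg (fun B : Y →L[ℝ] Y => B f) hR
      rw [this]
      exact mul_le_mul_of_nonneg_left hf (tsum_nonneg hc0)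
  obtain ⟨d, hd, hd'⟩ := exists_tendsto_bound hp hq hN K h1 T
  refine ⟨d, hd, fun n f hf => ?_⟩
  have h2 : (∑ k ∈ Finset.range n, K ∘L A ^ k) - K ∘L R = -(K ∘L (A ^ n * R)) := by
    have h3 : (∑ k ∈ Finset.range n, A ^ k) - R = -(A ^ n * R) := by
      have h4 : (∑ k ∈ Finset.range n, A ^ k) = (1 - A ^ n) * R := by
        rw [← geom_sum_mul_neg, mul_assoc, hR, mul_one]
      rw [h4]
      noncomm_ring
    rw [← ContinuousLinearMap.comp_neg, ← h3, ContinuousLinearMap.comp_sub,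
      ContinuousLinearMap.comp_finsetSum]
  rw [h2, neg_apply, map_neg_eq_map]
  exact hd' n f hf

/-! ### Convexity implies quadratic invariance -/

variable [ContinuousConstSMul ℝ Y]

/-- If `α • h(K) = h(K')`, then `K' = α • K (1 - (1 - α) G K)⁻¹`. -/
theorem eq_smul_comp_inverse_of_hMap_eq {G : U →L[ℝ] Y} {K K' : Y →L[ℝ] U} {α : ℝ}
    (hu : IsUnit (1 - G ∘L K)) (hu' : IsUnit (1 - G ∘L K'))
    (huα : IsUnit (1 - (1 - α) • (G ∘L K))) (h : hMap G K' = α • hMap G K) :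
    K' = α • (K ∘L Ring.inverse (1 - (1 - α) • (G ∘L K))) := by
  have hR : (1 - G ∘L K) * Ring.inverse (1 - G ∘L K) = 1 := Ring.mul_inverse_cancel _ hu
  have hR' : Ring.inverse (1 - G ∘L K') * (1 - G ∘L K') = 1 := Ring.inverse_mul_cancel _ hu'
  have hα : Ring.inverse (1 - (1 - α) • (G ∘L K)) * (1 - (1 - α) • (G ∘L K)) = 1 :=
    Ring.inverse_mul_cancel _ huα
  have h1 : 1 - Ring.inverse (1 - G ∘L K') = α • (1 - Ring.inverse (1 - G ∘L K)) := by
    rw [← comp_hMap hu, ← comp_hMap hu', h, ContinuousLinearMap.comp_smul]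
  have h0 : K' = α • (K ∘L (Ring.inverse (1 - G ∘L K) * (1 - G ∘L K'))) := by
    have e1 : K' = (-hMap G K') ∘L (1 - G ∘L K') := by
      rw [hMap, neg_neg, ContinuousLinearMap.comp_assoc]
      change K' = K' ∘L (Ring.inverse (1 - G ∘L K') * (1 - G ∘L K'))
      rw [hR']
      rfl
    nth_rewrite 1 [e1]
    rw [h, hMap, smul_neg, neg_neg, ContinuousLinearMap.smul_comp, ContinuousLinearMap.comp_assoc]
    rfl
  rw [h0]
  congr 2
  set A := G ∘L K
  set R := Ring.inverse (1 - A)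
  set X := 1 - G ∘L K'
  -- Since `R - AR = 1`, the combination `(1 - α) + αR` factors as `(1 - (1 - α)A) R`; hence `R X`
  -- is the inverse of `1 - (1 - α)A`.
  have h2 : Ring.inverse X = (1 - (1 - α) • A) * R := by
    have e1 : Ring.inverse X = 1 - α • (1 - R) := by rw [← h1, sub_sub_cancel]
    have e2 : A * R = R - 1 := by
      rw [sub_mul, one_mul] at hR
      rw [← hR]
      abel
    rw [e1, sub_mul, one_mul, smul_mul_assoc, e2]
    module
  calc R * X = (Ring.inverse (1 - (1 - α) • A) * (1 - (1 - α) • A)) * (R * X) := by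
        rw [hα, one_mul]
    _ = Ring.inverse (1 - (1 - α) • A) * (Ring.inverse X * X) := by
        rw [h2]
        simp only [mul_assoc]
    _ = _ := by rw [hR', mul_one]

theorem quadraticallyInvariant_of_smul_hMap_mem {p : SeminormFamily ℝ Y ι}
    {q : SeminormFamily ℝ U κ}
    (hp : WithSeminorms p) (hq : WithSeminorms q)
    (hcomp : SeriesComplete p) (hsep : Separates p) {N : Y → ℝ≥0∞}
    (hN : ∀ T f, N f ≤ 1 → p T f ≤ 1) {S : Submodule ℝ (Y →L[ℝ] U)} {G : U →L[ℝ] Y}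
    (hS : IsClosed[opTopologyOf N fun T f => ENNReal.ofReal (q T f)] (S : Set (Y →L[ℝ] U)))
    (hA : ∀ K ∈ S, PowersSummable p (G ∘L K))
    (h : ∀ K ∈ S, ∀ α : ℝ, 0 < α → α < 1 → ∃ K' ∈ S, hMap G K' = α • hMap G K) :
    QuadraticallyInvariant (S : Set (Y →L[ℝ] U)) G := by
  intro K hK
  have hAK := hA K hK
  have hunit : ∀ β : ℝ, 0 ≤ β → β ≤ 1 → IsUnit (1 - β • (G ∘L K)) := fun β h0 h1 =>
    (hAK.smul h0 h1).isUnit_one_sub hp hcomp hsep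
  set A := G ∘L K with hAdef
  have hRβ : ∀ β : ℝ, 0 ≤ β → β ≤ 1 →
      Ring.inverse (1 - β • A) - 1 = β • (A * Ring.inverse (1 - β • A)) := by
    intro β h0 h1
    have hR : (1 - β • A) * Ring.inverse (1 - β • A) = 1 :=
      Ring.mul_inverse_cancel _ (hunit β h0 h1)
    rw [sub_mul, one_mul, smul_mul_assoc] at hR
    rw [sub_eq_iff_eq_add, ← sub_eq_iff_eq_add', hR]
  have hmem : ∀ β : ℝ, 0 < β → β < 1 → K ∘L (A * Ring.inverse (1 - β • A)) ∈ S := by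
    intro β h0 h1
    obtain ⟨K', hK', hh⟩ := h K hK (1 - β) (by linarith) (by linarith)
    have e := eq_smul_comp_inverse_of_hMap_eq (hAK.isUnit_one_sub hp hcomp hsep)
      ((hA K' hK').isUnit_one_sub hp hcomp hsep)
      (hunit _ (by linarith) (by linarith)) hh
    rw [e, sub_sub_cancel] at hK'
    have h2 := (S.smul_mem_iff (by linarith : (1 - β) ≠ 0)).mp hK'
    have h3 := S.sub_mem h2 hK
    have h4 : K ∘L Ring.inverse (1 - β • A) - K = β • (K ∘L (A * Ring.inverse (1 - β • A))) := by
      rw [← ContinuousLinearMap.comp_smul K β, ← hRβ β h0.le h1.le, ContinuousLinearMap.comp_sub]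
      rfl
    rw [h4] at h3
    exact (S.smul_mem_iff h0.ne').mp h3
  -- The shift by 2 keeps `b n` strictly between 0 and 1, also at `n = 0`.
  set b : ℕ → ℝ := fun n => 1 / ((n : ℝ) + 2) with hb
  have hb0 : ∀ n, 0 < b n := fun n => by positivity
  have hb1 : ∀ n, b n < 1 := fun n => by
    rw [hb]
    simp only
    rw [div_lt_one (by positivity)]
    linarith [(Nat.cast_nonneg n : (0 : ℝ) ≤ n)]
  have hblim : Tendsto b atTop (𝓝 0) := by
    have := (tendsto_one_div_add_atTop_nhds_zero_nat (𝕜 := ℝ)).comp (tendsto_add_atTop_nat 1)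
    refine this.congr fun n => ?_
    simp only [Function.comp_apply, hb]
    push_cast
    ring
  refine mem_of_eOpNorm_tendsto hS (B := fun n => K ∘L (A * Ring.inverse (1 - b n • A)))
    (fun n => hmem _ (hb0 n) (hb1 n)) fun T => ?_
  -- The error is `K A² · b n (1 - b n A)⁻¹`: the resolvents are uniformly bounded, so the factor `b
  -- n` forces convergence.
  have h1 : ∀ T, ∃ c : ℕ → ℝ, Tendsto c atTop (𝓝 0) ∧
      ∀ n f, p T f ≤ 1 → p T ((b n • Ring.inverse (1 - b n • A)) f) ≤ c n := by
    intro T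
    obtain ⟨c, hc0, hc, h⟩ := hAK T
    refine ⟨fun n => b n * ((∑' n, c n) * 1), ?_, fun n f hf => ?_⟩
    · simpa using hblim.mul_const ((∑' n, c n) * 1)
    · rw [smul_apply, map_smul_eq_mul, Real.norm_of_nonneg (hb0 n).le]
      refine mul_le_mul_of_nonneg_left ?_ (hb0 n).le
      refine (le_tsum_mul_of_powers hc0 hc (powers_smul_le h (hb0 n).le (hb1 n).le) _).trans ?_
      have : (1 - b n • A) (Ring.inverse (1 - b n • A) f) = f :=
        congrArg (fun B : Y →L[ℝ] Y => B f)
          (Ring.mul_inverse_cancel _ (hunit _ (hb0 n).le (hb1 n).le))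
      rw [this]
      exact mul_le_mul_of_nonneg_left hf (tsum_nonneg hc0)
  obtain ⟨d, hd, hd'⟩ := exists_tendsto_bound hp hq hN (K ∘L (A * A)) h1 T
  refine ⟨d, hd, fun n f hf => ?_⟩
  convert hd' n f hf using 3
  have h6 : A * Ring.inverse (1 - b n • A) - A =
      (A * A) * (b n • Ring.inverse (1 - b n • A)) := by
    rw [mul_smul_comm, mul_assoc, ← mul_smul_comm, ← hRβ _ (hb0 n).le (hb1 n).le, mul_sub, mul_one]
  change K ∘L (A * Ring.inverse (1 - b n • A)) - K ∘L A =
    K ∘L ((A * A) * (b n • Ring.inverse (1 - b n • A)))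
  rw [← h6, ContinuousLinearMap.comp_sub]

/-! ### The equivalence for abstract spaces -/

variable [ContinuousConstSMul ℝ Z]

theorem isUnit_and_quadraticallyInvariant_iff_convex {p : SeminormFamily ℝ Y ι}
    {q : SeminormFamily ℝ U κ}
    (hp : WithSeminorms p) (hq : WithSeminorms q)
    (hcomp : SeriesComplete p) (hsep : Separates p) {N : Y → ℝ≥0∞}
    (hN : ∀ T f, N f ≤ 1 → p T f ≤ 1)
    (P₁₁ : W →L[ℝ] Z) (P₁₂ : U →L[ℝ] Z) (P₂₁ : W →L[ℝ] Y) (G : U →L[ℝ] Y)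
    (S : Submodule ℝ (Y →L[ℝ] U))
    (hS : IsClosed[opTopologyOf N fun T f => ENNReal.ofReal (q T f)] (S : Set (Y →L[ℝ] U)))
    (hA : ∀ K ∈ S, PowersSummable p (G ∘L K))
    (hL : ∃ L : Z →L[ℝ] U, L ∘L P₁₂ = ContinuousLinearMap.id ℝ U)
    (hR : ∃ R : Y →L[ℝ] W, P₂₁ ∘L R = ContinuousLinearMap.id ℝ Y) :
    (∀ K ∈ S, IsUnit (1 - G ∘L K)) ∧
      (QuadraticallyInvariant (S : Set (Y →L[ℝ] U)) G ↔
        Convex ℝ (closedLoopMaps P₁₁ P₁₂ P₂₁ G (S : Set (Y →L[ℝ] U)))) := by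
  have hunit : ∀ K ∈ S, IsUnit (1 - G ∘L K) := fun K hK =>
    (hA K hK).isUnit_one_sub hp hcomp hsep
  refine ⟨hunit, fun hQI => ?_, fun hconv => ?_⟩
  · have himage : hMap G '' (S : Set (Y →L[ℝ] U)) = S := by
      have hmem : ∀ K ∈ S, hMap G K ∈ S := fun K hK =>
        hMap_mem_of_quadraticallyInvariant hp hq hcomp hsep hN hS hQI hK (hA K hK)
      refine Subset.antisymm (image_subset_iff.mpr hmem) fun K hK => ?_
      exact ⟨hMap G K, hmem K hK, hMap_hMap (hunit K hK)⟩
    rw [closedLoopMaps, himage]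
    -- The signs of the weights are dropped: the set is even affine.
    rintro _ ⟨Q₁, hQ₁, rfl⟩ _ ⟨Q₂, hQ₂, rfl⟩ a b - - hab
    refine ⟨a • Q₁ + b • Q₂, S.add_mem (S.smul_mem a hQ₁) (S.smul_mem b hQ₂), ?_⟩
    have hP : P₁₁ = a • P₁₁ + b • P₁₁ := by rw [← add_smul, hab, one_smul]
    simp only
    nth_rewrite 1 [hP]
    simp only [ContinuousLinearMap.comp_add, ContinuousLinearMap.add_comp,
      ContinuousLinearMap.comp_smul, ContinuousLinearMap.smul_comp, smul_sub]
    abel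
  · obtain ⟨L, hL⟩ := hL
    obtain ⟨R, hR⟩ := hR
    refine quadraticallyInvariant_of_smul_hMap_mem hp hq hcomp hsep hN hS hA
      fun K hK α h0 h1 => ?_
    have hz : hMap G 0 = 0 := by simp [hMap]
    have hmem : ∀ K ∈ S, P₁₁ - P₁₂ ∘L hMap G K ∘L P₂₁ ∈
        closedLoopMaps P₁₁ P₁₂ P₂₁ G (S : Set (Y →L[ℝ] U)) := fun K hK =>
      ⟨_, ⟨K, hK, rfl⟩, rfl⟩
    obtain ⟨_, ⟨K', hK', rfl⟩, he⟩ := hconv (hmem K hK) (hmem 0 S.zero_mem) h0.le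
      (by linarith : 0 ≤ 1 - α) (by ring)
    refine ⟨K', hK', ?_⟩
    rw [hz] at he
    have he2 : P₁₂ ∘L hMap G K' ∘L P₂₁ = α • (P₁₂ ∘L hMap G K ∘L P₂₁) := by
      simp only [ContinuousLinearMap.zero_comp, ContinuousLinearMap.comp_zero] at he
      rw [← sub_eq_zero] at he ⊢
      rw [← neg_eq_zero, ← he]
      module
    have hred : ∀ Q : Y →L[ℝ] U, L ∘L (P₁₂ ∘L Q ∘L P₂₁) ∘L R = Q := fun Q => by
      calc L ∘L (P₁₂ ∘L Q ∘L P₂₁) ∘L R = (L ∘L P₁₂) ∘L Q ∘L (P₂₁ ∘L R) := rfl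
        _ = Q := by
          rw [hL, hR]
          rfl
    rw [← hred (hMap G K'), he2, ContinuousLinearMap.smul_comp, ContinuousLinearMap.comp_smul, hred]

end QI

end DecControl

end

noncomputable section

namespace DecControl

open Filter

/-! ### Discrete time: seminorms, causality and the response at time zero -/

namespace ell2e

variable {l m n : ℕ}

theorem eNorm_trunc_le (T : ℕ) (f : ell2e n) : eNorm (trunc T f) ≤ eNorm f := by
  refine ENNReal.rpow_le_rpow (ENNReal.tsum_le_tsum fun t => ?_) (by norm_num)
  rw [trunc]
  split_ifs <;> simp

theorem eNormT_ne_top (T : ℕ) (f : ell2e n) : eNormT T f ≠ ⊤ := by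
  refine ENNReal.rpow_ne_top_of_nonneg (by norm_num) ?_
  rw [tsum_eq_sum (s := Finset.range (T + 1))]
  · exact ENNReal.sum_ne_top.mpr fun t _ => by simp
  · intro t ht
    rw [trunc, if_neg (by simpa [Nat.lt_succ_iff] using ht)]
    simp

theorem eNormT_eq_ofReal (T : ℕ) (f : ell2e n) :
    eNormT T f = ENNReal.ofReal (seminormT n T f) := by
  rw [seminormT_eq, ENNReal.ofReal_toReal (eNormT_ne_top T f)]

theorem seminormT_le_one (T : ℕ) (f : ell2e n) (h : eNorm f ≤ 1) : seminormT n T f ≤ 1 := by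
  rw [seminormT_eq]
  exact ENNReal.toReal_mono ENNReal.one_ne_top ((eNorm_trunc_le T f).trans h)

theorem seminormT_trunc (T : ℕ) (f : ell2e n) : seminormT n T (trunc T f) = seminormT n T f := by
  rw [seminormT_eq, seminormT_eq, eNormT, eNormT]
  congr 2
  funext t
  simp only [trunc]
  split_ifs <;> rfl

theorem seminormT_trunc_le (T T' : ℕ) (f : ell2e n) :
    seminormT n T' (trunc T f) ≤ seminormT n T f := by
  rw [seminormT_eq, seminormT_eq]
  exact ENNReal.toReal_mono (eNormT_ne_top T f) (eNorm_trunc_le T' _)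

theorem norm_apply_le_seminormT {t T : ℕ} (ht : t ≤ T) (f : ell2e n) :
    ‖f t‖ ≤ seminormT n T f :=
  PiLp.norm_apply_le (p := 2) (WithLp.toLp 2 fun s : Fin (T + 1) => f s)
    ⟨t, Nat.lt_succ_iff.mpr ht⟩

theorem seminormT_le_sum (T : ℕ) (f : ell2e n) :
    seminormT n T f ≤ ∑ t ∈ Finset.range (T + 1), ‖f t‖ := by
  have h1 : seminormT n T f = √(∑ t ∈ Finset.range (T + 1), ‖f t‖ ^ 2) := by
    rw [Finset.sum_range]
    simp [seminormT, PiLp.norm_eq_of_L2, LinearMap.funLeft_apply]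
  rw [h1]
  refine Real.sqrt_le_iff.mpr ⟨Finset.sum_nonneg fun _ _ => norm_nonneg _, ?_⟩
  exact Finset.sum_sq_le_sq_sum_of_nonneg fun _ _ => norm_nonneg _

theorem separates (n : ℕ) : Separates (seminormT n) := fun f h => by
  funext t
  exact norm_le_zero_iff.mp ((norm_apply_le_seminormT le_rfl f).trans (h t).le)

theorem seriesComplete (n : ℕ) : SeriesComplete (seminormT n) := by
  intro u hu
  have hs : Summable u := Pi.summable.mpr fun t =>
    Summable.of_norm_bounded (hu t) fun k => norm_apply_le_seminormT le_rfl (u k)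
  refine ⟨∑' k, u k, fun T => ?_⟩
  have h1 := (tendsto_const_nhds (x := ∑' k, u k)).sub hs.hasSum.tendsto_sum_nat
  have h2 := (((withSeminorms n).continuous_seminorm T).tendsto _).comp h1
  rw [sub_self, map_zero] at h2
  exact h2

theorem IsCausal.comp {A : ell2e m →L[ℝ] ell2e n} {B : ell2e l →L[ℝ] ell2e m} (hA : IsCausal A)
    (hB : IsCausal B) : IsCausal (A ∘L B) := fun T f => by
  change trunc T (A (B (trunc T f))) = trunc T (A (B f))
  rw [← hA T (B (trunc T f)), hB, hA]

theorem IsTimeInvariant.comp {A : ell2e m →L[ℝ] ell2e n} {B : ell2e l →L[ℝ] ell2e m}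
    (hA : IsTimeInvariant A) (hB : IsTimeInvariant B) : IsTimeInvariant (A ∘L B) :=
  fun T f hT => by
    change shift T (A (B f)) = A (B (shift T f))
    rw [hA T _ hT, hB T _ hT]

theorem comp_mem_LTI {A : ell2e m →L[ℝ] ell2e n} {B : ell2e l →L[ℝ] ell2e m}
    (hA : A ∈ LTI m n) (hB : B ∈ LTI l m) : A ∘L B ∈ LTI l n :=
  ⟨hA.1.comp hB.1, hA.2.comp hB.2⟩

theorem pow_mem_LTI {A : ell2e n →L[ℝ] ell2e n} (hA : A ∈ LTI n n) (k : ℕ) : A ^ k ∈ LTI n n := by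
  induction k with
  | zero => exact ⟨fun T f => by
      funext t
      simp only [trunc, pow_zero, one_apply_eq_self]
      split_ifs <;> rfl, fun T f _ => rfl⟩
  | succ k ih =>
    rw [pow_succ]
    exact comp_mem_LTI ih hA

/-- Continuity alone may involve seminorms at later times. By causality `f` can be replaced by its
truncation at `T`, all of whose seminorms are at most that of `f` at `T`. -/
theorem IsCausal.exists_bound {A : ell2e m →L[ℝ] ell2e n} (hA : IsCausal A) (T : ℕ) :
    ∃ C, 0 ≤ C ∧ ∀ f, seminormT n T (A f) ≤ C * seminormT m T f := by
  obtain ⟨s, C, hC, h⟩ := exists_bound_of_withSeminorms (withSeminorms m) (withSeminorms n) A T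
  refine ⟨C * s.card, by positivity, fun f => ?_⟩
  rw [← seminormT_trunc T (A f), ← hA, seminormT_trunc, mul_assoc]
  refine (h _).trans (mul_le_mul_of_nonneg_left ?_ hC)
  refine (Finset.sum_le_card_nsmul s _ _ fun i _ => seminormT_trunc_le T i f).trans_eq ?_
  rw [nsmul_eq_mul]

theorem IsCausal.apply_trunc {A : ell2e m →L[ℝ] ell2e n} (hA : IsCausal A) (t : ℕ) (f : ell2e m) :
    A (trunc t f) t = A f t := by
  have := congrFun (hA t f) t
  simpa [trunc] using this

theorem trunc_zero_eq_single (f : ell2e n) : trunc 0 f = Pi.single 0 (f 0) := by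
  funext t
  rcases eq_or_ne t 0 with rfl | ht
  · simp [trunc]
  · simp [trunc, ht]

/-- The response at time `t` splits into the contribution of the strict past and that of the
present. -/
theorem apply_eq_add {A : ell2e m →L[ℝ] ell2e n} (hA : A ∈ LTI m n) (f : ell2e m) (t : ℕ) :
    A f t = A (fun s => if s < t then f s else 0) t + A (Pi.single 0 (f t)) 0 := by
  have h1 : trunc t f = (fun s => if s < t then f s else 0) + shift t (Pi.single 0 (f t)) := by
    funext s
    rcases lt_trichotomy s t with h | rfl | h
    · simp [trunc, shift, h, h.le]
    · simp [trunc, shift]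
    · simp [trunc, shift, h.not_ge, h.not_gt, (Nat.sub_pos_of_lt h).ne']
  have h2 : A (shift t (Pi.single 0 (f t))) t = A (Pi.single 0 (f t)) 0 := by
    rcases Nat.eq_zero_or_pos t with rfl | ht
    · rfl
    · rw [← hA.2 t _ ht]
      simp [shift]
  rw [← hA.1.apply_trunc, h1, map_add, Pi.add_apply, h2]

theorem apply_single_zero (A : ell2e m →L[ℝ] ell2e n) (v : EuclideanSpace ℝ (Fin m)) :
    A (Pi.single 0 v) 0 = WithLp.toLp 2 ((impulseResponse A 0).mulVec v) := by
  have h1 : (Pi.single 0 v : ell2e m) =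
      ∑ j, v j • (Pi.single 0 (EuclideanSpace.single j 1) : ell2e m) := by
    have hv : v = ∑ j, v j • EuclideanSpace.single j (1 : ℝ) := by
      ext i
      simp [Finset.sum_apply, Pi.single_apply]
    funext t
    rcases eq_or_ne t 0 with rfl | ht
    · simpa [Finset.sum_apply] using hv
    · simp [ht, Finset.sum_apply]
  rw [h1, map_sum]
  ext i
  simp [Finset.sum_apply, impulseResponse, Matrix.mulVec, dotProduct, mul_comm]

/-- By causality the output at time 0 depends only on the input at time 0, so composition there is
matrix multiplication. -/
theorem pow_apply_single_zero {A : ell2e n →L[ℝ] ell2e n} (hA : A ∈ LTI n n) (k : ℕ)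
    (v : EuclideanSpace ℝ (Fin n)) :
    (A ^ k) (Pi.single 0 v) 0 = WithLp.toLp 2 ((impulseResponse A 0 ^ k).mulVec v) := by
  induction k with
  | zero => simp
  | succ k ih =>
    rw [pow_succ']
    change A ((A ^ k) (Pi.single 0 v)) 0 = _
    rw [← hA.1.apply_trunc, trunc_zero_eq_single, ih, apply_single_zero, pow_succ',
      Matrix.mulVec_mulVec]

-- The spectral radius is taken over `ℂ`; the isometric inclusion of `ℝⁿ` in `ℂⁿ` carries the
-- complex norm bound back to real vectors.
open scoped Matrix.Norms.L2Operator in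
theorem norm_mulVec_le (M : Matrix (Fin n) (Fin n) ℝ) (v : EuclideanSpace ℝ (Fin n)) :
    ‖WithLp.toLp 2 (M.mulVec v)‖ ≤ ‖M.map Complex.ofReal‖ * ‖v‖ := by
  have h1 := Matrix.l2_opNorm_mulVec (M.map Complex.ofReal) (WithLp.toLp 2 fun i => (v i : ℂ))
  have h2 : ‖(WithLp.toLp 2 fun i => (v i : ℂ) : EuclideanSpace ℂ (Fin n))‖ = ‖v‖ := by
    simp [EuclideanSpace.norm_eq]
  have h3 : ‖(EuclideanSpace.equiv (Fin n) ℂ).symm ((M.map Complex.ofReal).mulVec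
      fun i => (v i : ℂ))‖ = ‖WithLp.toLp 2 (M.mulVec v)‖ := by
    rw [EuclideanSpace.norm_eq, EuclideanSpace.norm_eq]
    congr 1
    refine Finset.sum_congr rfl fun i _ => ?_
    have : ((EuclideanSpace.equiv (Fin n) ℂ).symm ((M.map Complex.ofReal).mulVec
      fun i => (v i : ℂ))) i = ((M.mulVec v i : ℝ) : ℂ) := by
      simp [Matrix.mulVec, dotProduct]
    rw [this, Complex.norm_real]
  rw [h2] at h1
  rw [← h3]
  exact h1

end ell2e

/-- In a complex Banach algebra, an element of spectral radius less than `1` has a power of small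
norm. -/
theorem exists_norm_pow_le_half_of_spectralRadius_lt_one {E : Type*} [NormedRing E]
    [NormedAlgebra ℂ E] [CompleteSpace E] {a : E} (h : spectralRadius ℂ a < 1) :
    ∃ k, 0 < k ∧ ‖a ^ k‖ ≤ 1 / 2 := by
  obtain ⟨θ, hθ, hθ1⟩ := ENNReal.lt_iff_exists_nnreal_btwn.mp h
  have hθ1 : θ < 1 := by exact_mod_cast hθ1
  have h1 := (spectrum.pow_nnnorm_pow_one_div_tendsto_nhds_spectralRadius a).eventually_lt_const hθ
  have h2 := (tendsto_pow_atTop_nhds_zero_of_lt_one θ.2 (by exact_mod_cast hθ1)).eventually_lt_const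
    (by norm_num : (0 : ℝ) < 1 / 2)
  obtain ⟨k, ⟨hk1, hk2⟩, hk⟩ := ((h1.and h2).and (eventually_gt_atTop 0)).exists
  refine ⟨k, hk, le_trans ?_ hk2.le⟩
  have h3 : (‖a ^ k‖₊ : ℝ≥0∞) ≤ (θ : ℝ≥0∞) ^ k := by
    have h4 := ENNReal.rpow_le_rpow hk1.le (Nat.cast_nonneg k : (0 : ℝ) ≤ k)
    rwa [← ENNReal.rpow_mul, one_div, inv_mul_cancel₀ (by positivity), ENNReal.rpow_one,
      ENNReal.rpow_natCast] at h4
  exact_mod_cast h3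

theorem summable_pow_div {r : ℝ} (h0 : 0 < r) (h1 : r < 1) {k : ℕ} (hk : 0 < k) :
    Summable fun n : ℕ => r ^ (n / k) := by
  have hk' : (0 : ℝ) < k := by exact_mod_cast hk
  have hθ : r ^ (1 / k : ℝ) < 1 := Real.rpow_lt_one h0.le h1 (by positivity)
  refine Summable.of_nonneg_of_le (fun n => by positivity) (fun n => ?_)
    ((summable_geometric_of_lt_one (by positivity) hθ).mul_left r⁻¹)
  -- Here `n / k` is floor division; the factor `r⁻¹` absorbs the rounding, as `n / k + 1` exceeds
  -- the real quotient.
  rw [← Real.rpow_natCast (r ^ (1 / k : ℝ)), ← Real.rpow_mul h0.le, le_inv_mul_iff₀ h0,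
    ← pow_succ', ← Real.rpow_natCast]
  refine Real.rpow_le_rpow_of_exponent_ge h0 h1.le ?_
  rw [one_div, inv_mul_le_iff₀ hk']
  have := Nat.lt_mul_div_succ n hk
  exact_mod_cast this.le

/-! ### Discrete time: summable powers from a weighted norm -/

namespace ell2e

variable {n : ℕ}

/-- If the response of `B` at time `0` is a contraction, then `B` contracts a weighted norm. -/
theorem exists_weight_contraction {B : ell2e n →L[ℝ] ell2e n} (hB : B ∈ LTI n n)
    (h0 : ∀ v, ‖B (Pi.single 0 v) 0‖ ≤ 1 / 2 * ‖v‖) (T : ℕ) :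
    ∃ ε : ℝ, 0 < ε ∧ ε ≤ 1 ∧ ∀ f, ∑ t ∈ Finset.range (T + 1), ε ^ t * ‖B f t‖ ≤
      3 / 4 * ∑ t ∈ Finset.range (T + 1), ε ^ t * ‖f t‖ := by
  obtain ⟨C, hC, hCB⟩ := hB.1.exists_bound T
  have hT : (0 : ℝ) ≤ T := T.cast_nonneg
  -- Chosen so that the past contributes at most `(T + 1) C ε ≤ 1/4`, which with the `1/2` of the
  -- present gives `3/4`.
  set ε : ℝ := 1 / (4 * (C + 1) * (T + 1)) with hε
  have hε0 : 0 < ε := by positivity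
  have hε1 : ε ≤ 1 := by
    rw [hε, div_le_one (by positivity)]
    nlinarith [mul_nonneg hC hT]
  refine ⟨ε, hε0, hε1, fun f => ?_⟩
  set w := ∑ t ∈ Finset.range (T + 1), ε ^ t * ‖f t‖ with hw
  have hw0 : 0 ≤ w := Finset.sum_nonneg fun t _ => by positivity
  -- An input at time `s < t` gains a factor `ε` over its own weight, since `ε^t ≤ ε · ε^s`.
  have hpast : ∀ t ∈ Finset.range (T + 1),
      ε ^ t * ‖B (fun s => if s < t then f s else 0) t‖ ≤ C * (ε * w) := by
    intro t ht
    have ht' : t ≤ T := Nat.lt_succ_iff.mp (Finset.mem_range.mp ht)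
    calc ε ^ t * ‖B (fun s => if s < t then f s else 0) t‖
        ≤ ε ^ t * (C * ∑ s ∈ Finset.range (T + 1), ‖if s < t then f s else 0‖) := by
          gcongr
          refine (norm_apply_le_seminormT ht' _).trans ((hCB _).trans ?_)
          gcongr
          exact seminormT_le_sum T _
      _ = C * ∑ s ∈ Finset.range (T + 1), ε ^ t * ‖if s < t then f s else 0‖ := by
          rw [← Finset.mul_sum]
          ring
      _ ≤ C * ∑ s ∈ Finset.range (T + 1), ε * (ε ^ s * ‖f s‖) := by
          refine mul_le_mul_of_nonneg_left (Finset.sum_le_sum fun s _ => ?_) hC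
          split_ifs with hs
          · rw [← mul_assoc, ← pow_succ']
            exact mul_le_mul_of_nonneg_right (pow_le_pow_of_le_one hε0.le hε1 hs) (norm_nonneg _)
          · rw [norm_zero, mul_zero]
            positivity
      _ = C * (ε * w) := by rw [hw, ← Finset.mul_sum]
  calc ∑ t ∈ Finset.range (T + 1), ε ^ t * ‖B f t‖
      ≤ ∑ t ∈ Finset.range (T + 1), (C * (ε * w) + 1 / 2 * (ε ^ t * ‖f t‖)) := by
        refine Finset.sum_le_sum fun t ht => ?_
        rw [apply_eq_add hB f t]
        have h1 := norm_add_le (B (fun s => if s < t then f s else 0) t) (B (Pi.single 0 (f t)) 0)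
        have h2 := mul_le_mul_of_nonneg_left (h1.trans (add_le_add_right (h0 (f t)) _))
          (pow_nonneg hε0.le t)
        have h3 := hpast t ht
        linarith
    _ = ((T + 1) * C * ε + 1 / 2) * w := by
        rw [Finset.sum_add_distrib, ← Finset.mul_sum (f := fun t => ε ^ t * ‖f t‖), ← hw]
        simp
        ring
    _ ≤ 3 / 4 * w := by
        refine mul_le_mul_of_nonneg_right ?_ hw0
        have : (T + 1) * C * ε ≤ 1 / 4 := by
          rw [hε, mul_one_div, div_le_div_iff₀ (by positivity) (by positivity)]
          nlinarith
        linarith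

/-- Gelfand's formula makes some `A^k` contract at time zero by `1/2`, hence contract a weighted
norm by `3/4`. Writing `A^j` as `A^(j % k) (A^k)^(j / k)` gives geometric decay. -/
theorem powersSummable {A : ell2e n →L[ℝ] ell2e n} (hA : A ∈ LTI n n)
    (hr : spectralRadius ℂ ((impulseResponse A 0).map Complex.ofReal) < 1) :
    PowersSummable (seminormT n) A := by
  obtain ⟨k, hk, hkA⟩ : ∃ k, 0 < k ∧ ∀ v, ‖(A ^ k) (Pi.single 0 v) 0‖ ≤ 1 / 2 * ‖v‖ := by
    open scoped Matrix.Norms.L2Operator in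
    obtain ⟨k, hk, h⟩ := exists_norm_pow_le_half_of_spectralRadius_lt_one hr
    refine ⟨k, hk, fun v => ?_⟩
    rw [pow_apply_single_zero hA]
    refine (norm_mulVec_le _ v).trans (mul_le_mul_of_nonneg_right ?_ (norm_nonneg _))
    have e : (impulseResponse A 0 ^ k).map Complex.ofReal =
        (impulseResponse A 0).map Complex.ofReal ^ k :=
      map_pow (Complex.ofRealHom.mapMatrix) (impulseResponse A 0) k
    rw [e]
    exact h
  intro T
  obtain ⟨ε, hε0, hε1, hε⟩ := exists_weight_contraction (pow_mem_LTI hA k) hkA T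
  choose C hC0 hC using fun r => (pow_mem_LTI hA r).1.exists_bound T
  have hpow : ∀ q f, ∑ t ∈ Finset.range (T + 1), ε ^ t * ‖((A ^ k) ^ q) f t‖ ≤
      (3 / 4) ^ q * ∑ t ∈ Finset.range (T + 1), ε ^ t * ‖f t‖ := by
    intro q f
    induction q with
    | zero => simp
    | succ q ih =>
      rw [pow_succ' (A ^ k)]
      refine (hε _).trans ?_
      rw [pow_succ' (3 / 4 : ℝ), mul_assoc]
      exact mul_le_mul_of_nonneg_left ih (by norm_num)
  have hq : ∀ q f, seminormT n T (((A ^ k) ^ q) f) ≤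
      (ε ^ T)⁻¹ * ((3 / 4) ^ q * ((T + 1) * seminormT n T f)) := by
    intro q f
    rw [le_inv_mul_iff₀ (by positivity)]
    calc ε ^ T * seminormT n T (((A ^ k) ^ q) f)
        ≤ ε ^ T * ∑ t ∈ Finset.range (T + 1), ‖((A ^ k) ^ q) f t‖ := by
          gcongr
          exact seminormT_le_sum T _
      _ ≤ ∑ t ∈ Finset.range (T + 1), ε ^ t * ‖((A ^ k) ^ q) f t‖ := by
          rw [Finset.mul_sum]
          refine Finset.sum_le_sum fun t ht => mul_le_mul_of_nonneg_right ?_ (norm_nonneg _)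
          exact pow_le_pow_of_le_one hε0.le hε1 (Nat.lt_succ_iff.mp (Finset.mem_range.mp ht))
      _ ≤ _ := hpow q f
      _ ≤ (3 / 4) ^ q * ((T + 1) * seminormT n T f) := by
          refine mul_le_mul_of_nonneg_left ?_ (by positivity)
          refine (Finset.sum_le_card_nsmul _ _ (seminormT n T f) fun t ht => ?_).trans_eq (by simp)
          exact (mul_le_of_le_one_left (norm_nonneg _) (pow_le_one₀ hε0.le hε1)).trans
            (norm_apply_le_seminormT (Nat.lt_succ_iff.mp (Finset.mem_range.mp ht)) f)
  -- The sum of the `C r` covers every remainder `j % k`; `(ε ^ T)⁻¹ * (T + 1)` is the cost of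
  -- passing to the weighted norm and back.
  refine ⟨fun j => (∑ r ∈ Finset.range k, C r) * ((ε ^ T)⁻¹ * (T + 1)) * (3 / 4) ^ (j / k),
    fun j => ?_, (summable_pow_div (by norm_num) (by norm_num) hk).mul_left _, fun j f => ?_⟩
  · have := Finset.sum_nonneg fun r (_ : r ∈ Finset.range k) => hC0 r
    positivity
  · have e : (A ^ j) f = (A ^ (j % k)) (((A ^ k) ^ (j / k)) f) := by
      conv_lhs => rw [← Nat.mod_add_div j k, pow_add, pow_mul]
      rfl
    rw [e]
    refine (hC _ _).trans ?_
    have h1 : C (j % k) ≤ ∑ r ∈ Finset.range k, C r :=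
      Finset.single_le_sum (fun r _ => hC0 r) (Finset.mem_range.mpr (Nat.mod_lt j hk))
    refine (mul_le_mul h1 (hq _ _) (apply_nonneg _ _) ((hC0 _).trans h1)).trans_eq ?_
    ring

end ell2e

end DecControl

end

noncomputable section

namespace DecControl

open Filter

/-! ### Continuous time: completeness and Volterra estimates -/

namespace L2e

variable {l m n : ℕ}

theorem eNormT_eq_restrict (T : ℝ≥0) (f : L2e n) :
    eNormT T f = eLpNorm f.toFun 2 (timeMeasure.restrict (Iic (T : ℝ))) :=
  eLpNorm_indicator_eq_eLpNorm_restrict measurableSet_Iic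

theorem eNormT_ne_top (T : ℝ≥0) (f : L2e n) : eNormT T f ≠ ⊤ := (f.memLp_trunc T).2.ne

theorem seminormT_apply (T : ℝ≥0) (f : L2e n) : seminormT n T f = (eNormT T f).toReal := rfl

theorem eNormT_eq_ofReal (T : ℝ≥0) (f : L2e n) :
    eNormT T f = ENNReal.ofReal (seminormT n T f) := by
  rw [seminormT_apply, ENNReal.ofReal_toReal (eNormT_ne_top T f)]

theorem seminormT_le_one (T : ℝ≥0) (f : L2e n) (h : eNorm f ≤ 1) : seminormT n T f ≤ 1 := by
  refine ENNReal.toReal_mono ENNReal.one_ne_top (le_trans ?_ h)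
  exact eLpNorm_indicator_le _

/-- A property that holds a.e. on every bounded time interval holds a.e. -/
theorem ae_of_forall_ae_restrict {P : ℝ → Prop}
    (h : ∀ T : ℝ≥0, ∀ᵐ t ∂timeMeasure.restrict (Iic (T : ℝ)), P t) : ∀ᵐ t ∂timeMeasure, P t := by
  have h1 : ∀ᵐ t ∂timeMeasure, ∀ N : ℕ, t ≤ (N : ℝ) → P t := by
    refine ae_all_iff.mpr fun N => ?_
    have := (ae_restrict_iff' measurableSet_Iic).mp (h N)
    simpa only [mem_Iic, NNReal.coe_natCast] using this
  filter_upwards [h1] with t ht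
  obtain ⟨N, hN⟩ := exists_nat_ge t
  exact ht N hN

theorem ext_ae {f g : L2e n} (h : f.toFun =ᵐ[timeMeasure] g.toFun) : f = g :=
  Subtype.ext (AEEqFun.ext h)

theorem toFun_zero : (0 : L2e n).toFun =ᵐ[timeMeasure] 0 := AEEqFun.coeFn_zero

theorem toFun_sub (f g : L2e n) : (f - g).toFun =ᵐ[timeMeasure] f.toFun - g.toFun :=
  AEEqFun.coeFn_sub f.1 g.1

theorem toFun_sum (u : ℕ → L2e n) (N : ℕ) :
    (∑ k ∈ Finset.range N, u k).toFun =ᵐ[timeMeasure]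
      fun t => ∑ k ∈ Finset.range N, (u k).toFun t := by
  induction N with
  | zero =>
    filter_upwards [toFun_zero (n := n)] with t ht
    simpa using ht
  | succ N ih =>
    rw [Finset.sum_range_succ]
    filter_upwards [toFun_add (∑ k ∈ Finset.range N, u k) (u N), ih] with t h1 h2
    rw [h1, Pi.add_apply, h2, Finset.sum_range_succ]

theorem toFun_mk (f : ℝ → EuclideanSpace ℝ (Fin n)) (hf : AEStronglyMeasurable f timeMeasure)
    (h : ∀ T : ℝ≥0, MemLp (truncFun T f) 2 timeMeasure) : (mk f hf h).toFun =ᵐ[timeMeasure] f :=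
  AEEqFun.coeFn_mk f hf

theorem separates (n : ℕ) : Separates (seminormT n) := fun f h => by
  refine ext_ae (EventuallyEq.trans ?_ toFun_zero.symm)
  refine ae_of_forall_ae_restrict fun T => ?_
  have h1 : eNormT T f = 0 := by rw [eNormT_eq_ofReal, h T, ENNReal.ofReal_zero]
  rw [eNormT_eq_restrict,
    eLpNorm_eq_zero_iff f.stronglyMeasurable.aestronglyMeasurable (by norm_num)] at h1
  exact h1

instance isFiniteMeasure_restrict_Iic (T : ℝ≥0) :
    IsFiniteMeasure (timeMeasure.restrict (Iic (T : ℝ))) := by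
  rw [timeMeasure, Measure.restrict_restrict measurableSet_Iic, inter_comm, Ici_inter_Iic]
  infer_instance

/-- A local Riesz–Fischer argument: the series converges absolutely a.e. on each bounded interval,
and Fatou bounds the tail of its pointwise sum by the tail of the norms. -/
theorem seriesComplete (n : ℕ) : SeriesComplete (seminormT n) := by
  intro u hu
  have hne : ∀ T, ∑' k, eNormT T (u k) ≠ ⊤ := fun T => by
    simp only [eNormT_eq_ofReal]
    exact (hu T).tsum_ofReal_ne_top
  have hm : ∀ (ν : Measure ℝ) k, AEStronglyMeasurable (u k).toFun ν := fun ν k =>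
    (u k).stronglyMeasurable.aestronglyMeasurable
  have hsum : ∀ᵐ t ∂timeMeasure, Summable fun k => (u k).toFun t := by
    refine ae_of_forall_ae_restrict fun T => ?_
    have h1 := summable_norm_of_tsum_eLpNorm_ne_top (p := 2) (by norm_num)
      (hm (timeMeasure.restrict (Iic (T : ℝ)))) (by
        simp only [← eNormT_eq_restrict]
        exact hne T)
    filter_upwards [h1] with t ht using ht.of_norm
  set F : ℝ → EuclideanSpace ℝ (Fin n) := fun t => ∑' k, (u k).toFun t with hF
  have hmeas : ∀ N, AEStronglyMeasurable
      (fun t => F t - ∑ k ∈ Finset.range N, (u k).toFun t) timeMeasure := by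
    have h1 : ∀ N, AEStronglyMeasurable
        (fun t => ∑ k ∈ Finset.range N, (u k).toFun t) timeMeasure := fun N =>
      Finset.aestronglyMeasurable_fun_sum _ fun k _ => hm _ k
    have h2 : AEStronglyMeasurable F timeMeasure := by
      refine aestronglyMeasurable_of_tendsto_ae atTop h1 ?_
      filter_upwards [hsum] with t ht using ht.hasSum.tendsto_sum_nat
    exact fun N => h2.sub (h1 N)
  have htail : ∀ (T : ℝ≥0) N, eLpNorm (fun t => F t - ∑ k ∈ Finset.range N, (u k).toFun t) 2
      (timeMeasure.restrict (Iic (T : ℝ))) ≤ ∑' k, eNormT T (u (k + N)) := by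
    intro T N
    have hlim : ∀ᵐ t ∂timeMeasure.restrict (Iic (T : ℝ)),
        Tendsto (fun M => (∑ k ∈ Finset.range M, (u (k + N)).toFun) t) atTop
          (𝓝 (F t - ∑ k ∈ Finset.range N, (u k).toFun t)) := by
      filter_upwards [ae_restrict_of_ae hsum] with t ht
      simp only [Finset.sum_apply]
      rw [show F t = _ from (ht.sum_add_tsum_nat_add N).symm, add_sub_cancel_left]
      exact ((summable_nat_add_iff N).mpr ht).hasSum.tendsto_sum_nat
    refine (Lp.eLpNorm_lim_le_liminf_eLpNorm
      (fun M => Finset.aestronglyMeasurable_sum _ fun k _ => hm _ (k + N)) _ hlim).trans ?_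
    refine liminf_le_of_frequently_le' (Frequently.of_forall fun M => ?_)
    refine (eLpNorm_sum_le (fun k _ => hm _ (k + N)) (by norm_num)).trans ?_
    simp only [← eNormT_eq_restrict]
    exact ENNReal.sum_le_tsum _
  -- The tail bound with `N = 0` is the norm bound for `F` itself.
  have hmem : ∀ T : ℝ≥0, MemLp (truncFun T F) 2 timeMeasure := by
    intro T
    have h1 := htail T 0
    have h2 := hmeas 0
    simp only [Finset.range_zero, Finset.sum_empty, sub_zero, add_zero] at h1 h2
    refine ⟨h2.indicator measurableSet_Iic, ?_⟩
    rw [truncFun, eLpNorm_indicator_eq_eLpNorm_restrict measurableSet_Iic]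
    exact h1.trans_lt (hne T).lt_top
  have hF0 : AEStronglyMeasurable F timeMeasure := by simpa using hmeas 0
  refine ⟨mk F hF0 hmem, fun T => ?_⟩
  have h1 : Tendsto (fun N => eNormT T (mk F hF0 hmem - ∑ k ∈ Finset.range N, u k)) atTop
      (𝓝 0) := by
    refine tendsto_of_tendsto_of_tendsto_of_le_of_le tendsto_const_nhds
      (ENNReal.tendsto_sum_nat_add _ (hne T)) (fun N => zero_le) fun N => ?_
    rw [eNormT_eq_restrict]
    refine (eLpNorm_congr_ae ?_).trans_le (htail T N)
    filter_upwards [ae_restrict_of_ae (toFun_sub (mk F hF0 hmem) (∑ k ∈ Finset.range N, u k)),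
      ae_restrict_of_ae (toFun_mk F hF0 hmem), ae_restrict_of_ae (toFun_sum u N)] with t e1 e2 e3
    rw [e1, Pi.sub_apply, e2, e3]
  exact (ENNReal.tendsto_toReal ENNReal.zero_ne_top).comp h1

theorem HasBoundedImpulseResponse.exists_bound {A : L2e m →L[ℝ] L2e n}
    {a : ℝ → Matrix (Fin n) (Fin m) ℝ} (h : HasBoundedImpulseResponse A a) (T : ℝ≥0) :
    ∃ M : ℝ≥0, ∀ᵐ t, t ∈ Icc 0 (T : ℝ) → ∀ i j, ‖a t i j‖ₑ ≤ M := by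
  set b : Fin n → Fin m → ℝ≥0∞ := fun i j =>
    eLpNormEssSup (truncFun T fun t => a t i j) timeMeasure
  have hb : ∀ i j, b i j ≠ ⊤ := fun i j => by
    have := (h.1 i j T).2.ne
    rwa [eLpNorm_exponent_top] at this
  refine ⟨∑ i, ∑ j, (b i j).toNNReal, ?_⟩
  have h1 : ∀ᵐ t ∂timeMeasure, ∀ i j, ‖truncFun T (fun t => a t i j) t‖ₑ ≤ b i j :=
    ae_all_iff.mpr fun i => ae_all_iff.mpr fun j => enorm_ae_le_eLpNormEssSup _ _
  rw [timeMeasure, ae_restrict_iff' measurableSet_Ici] at h1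
  filter_upwards [h1] with t ht htT i j
  have h2 := ht htT.1 i j
  rw [truncFun, indicator_of_mem (show t ∈ Iic (T : ℝ) from htT.2)] at h2
  refine h2.trans ?_
  rw [← ENNReal.coe_toNNReal (hb i j), ENNReal.coe_le_coe]
  refine le_trans ?_ (Finset.single_le_sum (f := fun i => ∑ j, (b i j).toNNReal)
    (fun _ _ => zero_le) (Finset.mem_univ i))
  exact Finset.single_le_sum (f := fun j => (b i j).toNNReal)
    (fun _ _ => zero_le) (Finset.mem_univ j)

theorem enorm_le_sum (v : EuclideanSpace ℝ (Fin n)) : ‖v‖ₑ ≤ ∑ i, ‖v i‖ₑ := by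
  have hv : v = ∑ i, v i • EuclideanSpace.single i (1 : ℝ) := by
    ext i
    simp [Finset.sum_apply, Pi.single_apply]
  calc ‖v‖ₑ = ‖∑ i, v i • EuclideanSpace.single i (1 : ℝ)‖ₑ := by rw [← hv]
    _ ≤ ∑ i, ‖v i • EuclideanSpace.single i (1 : ℝ)‖ₑ := enorm_sum_le _ _
    _ = ∑ i, ‖v i‖ₑ := by
      refine Finset.sum_congr rfl fun i _ => ?_
      rw [enorm_smul]
      simp [enorm_eq_nnnorm]

/-- A convolution with a locally bounded kernel is dominated pointwise by an integral of the
input. -/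
theorem HasBoundedImpulseResponse.exists_volterra_bound {A : L2e m →L[ℝ] L2e n}
    {a : ℝ → Matrix (Fin n) (Fin m) ℝ} (h : HasBoundedImpulseResponse A a) (T : ℝ≥0) :
    ∃ C : ℝ≥0, ∀ f, ∀ᵐ t, t ∈ Icc 0 (T : ℝ) →
      ‖(A f).toFun t‖ₑ ≤ C * ∫⁻ s in Icc 0 t, ‖f.toFun s‖ₑ := by
  obtain ⟨M, hM⟩ := h.exists_bound T
  refine ⟨n * (m * M), fun f => ?_⟩
  have h1 := h.2 f
  rw [timeMeasure, ae_restrict_iff' measurableSet_Ici] at h1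
  filter_upwards [h1] with t ht htT
  -- The kernel bound holds only a.e.; the reflection `s ↦ t - s` preserves Lebesgue measure, so the
  -- exceptional set stays null.
  have hker : ∀ᵐ s, s ∈ Ioc 0 t → ∀ i j, ‖a (t - s) i j‖ₑ ≤ M := by
    filter_upwards [(Measure.measurePreserving_sub_left volume t).quasiMeasurePreserving.ae hM]
      with s hs hst
    exact hs ⟨by linarith [hst.2], by linarith [hst.1, htT.2]⟩
  have hentry : ∀ i j, ‖∫ s in (0 : ℝ)..t, a (t - s) i j * f.toFun s j‖ₑ ≤
      M * ∫⁻ s in Icc 0 t, ‖f.toFun s‖ₑ := by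
    intro i j
    rw [intervalIntegral.integral_of_le htT.1]
    refine (enorm_integral_le_lintegral_enorm _).trans ?_
    rw [← lintegral_const_mul' _ _ ENNReal.coe_ne_top]
    refine le_trans ?_ (lintegral_mono_set Ioc_subset_Icc_self)
    refine lintegral_mono_ae ?_
    refine (ae_restrict_iff' measurableSet_Ioc).mpr ?_
    filter_upwards [hker] with s hs hst
    rw [enorm_mul]
    refine mul_le_mul' (hs hst i j) ?_
    rw [enorm_le_iff_norm_le]
    exact PiLp.norm_apply_le _ j
  calc ‖(A f).toFun t‖ₑ ≤ ∑ i, ‖(A f).toFun t i‖ₑ := enorm_le_sum _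
    _ ≤ ∑ _i : Fin n, ∑ _j : Fin m, M * ∫⁻ s in Icc 0 t, ‖f.toFun s‖ₑ := by
      refine Finset.sum_le_sum fun i _ => ?_
      rw [ht htT.1 i]
      exact (enorm_sum_le _ _).trans (Finset.sum_le_sum fun j _ => hentry i j)
    _ = _ := by
      simp
      ring

theorem lintegral_volterra_pow (C : ℝ≥0) (k : ℕ) {t : ℝ} (ht : 0 ≤ t) :
    C * ∫⁻ s in Icc 0 t, ENNReal.ofReal ((C * s) ^ k / k.factorial) =
      ENNReal.ofReal ((C * t) ^ (k + 1) / (k + 1).factorial) := by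
  have h1 : ∫ s in (0 : ℝ)..t, (C * s) ^ k / k.factorial =
      C ^ k * t ^ (k + 1) / (k + 1).factorial := by
    simp only [mul_pow]
    rw [intervalIntegral.integral_div, intervalIntegral.integral_const_mul, integral_pow,
      Nat.factorial_succ]
    push_cast
    field_simp
    simp
  have hint : IntegrableOn (fun s : ℝ => ((C : ℝ) * s) ^ k / k.factorial) (Icc 0 t) :=
    Continuous.integrableOn_Icc (by fun_prop)
  rw [← ofReal_integral_eq_lintegral_ofReal hint, integral_Icc_eq_integral_Ioc,
    ← intervalIntegral.integral_of_le ht, h1, ← ENNReal.ofReal_coe_nnreal,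
    ← ENNReal.ofReal_mul (p := (C : ℝ)) C.2]
  · congr 1
    rw [mul_pow, pow_succ' (C : ℝ)]
    ring
  · refine (ae_restrict_iff' measurableSet_Icc).mpr ?_
    refine Eventually.of_forall fun s hs => ?_
    have := hs.1
    simp only [Pi.zero_apply]
    positivity

/-- The first application of `A` turns an integral of `f` into a pointwise bound; each further one
integrates the power `(Ct)^k / k!` once more, by `lintegral_volterra_pow`. -/
theorem enorm_pow_succ_apply_le {A : L2e n →L[ℝ] L2e n} {T C : ℝ≥0}
    (h : ∀ f, ∀ᵐ t, t ∈ Icc 0 (T : ℝ) →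
      ‖(A f).toFun t‖ₑ ≤ C * ∫⁻ s in Icc 0 t, ‖f.toFun s‖ₑ) (f : L2e n) (k : ℕ) :
    ∀ᵐ t, t ∈ Icc 0 (T : ℝ) → ‖((A ^ (k + 1)) f).toFun t‖ₑ ≤
      C * ENNReal.ofReal ((C * t) ^ k / k.factorial) * ∫⁻ s in Icc 0 (T : ℝ), ‖f.toFun s‖ₑ := by
  induction k with
  | zero =>
    filter_upwards [h f] with t ht htT
    simp only [zero_add, pow_one, pow_zero, Nat.factorial_zero, Nat.cast_one, div_one,
      ENNReal.ofReal_one, mul_one]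
    refine (ht htT).trans ?_
    gcongr
    exact htT.2
  | succ k ih =>
    filter_upwards [h ((A ^ (k + 1)) f)] with t ht htT
    rw [pow_succ']
    refine (ht htT).trans ?_
    set I := ∫⁻ s in Icc 0 (T : ℝ), ‖f.toFun s‖ₑ
    calc C * ∫⁻ s in Icc 0 t, ‖((A ^ (k + 1)) f).toFun s‖ₑ
        ≤ C * ∫⁻ s in Icc 0 t, C * ENNReal.ofReal ((C * s) ^ k / k.factorial) * I := by
          refine mul_le_mul_right (lintegral_mono_ae ?_) _
          refine (ae_restrict_iff' measurableSet_Icc).mpr ?_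
          filter_upwards [ih] with s hs hst
          exact hs ⟨hst.1, hst.2.trans htT.2⟩
      _ = C * (C * ∫⁻ s in Icc 0 t, ENNReal.ofReal ((C * s) ^ k / k.factorial)) * I := by
          rw [lintegral_mul_const _ (by fun_prop), lintegral_const_mul _ (by fun_prop)]
          ring
      _ = _ := by rw [lintegral_volterra_pow C k htT.1]

/-- The bounds are terms of an exponential series, so no smallness of the kernel is needed. One
factor `D = |[0,T]|^(1/2)` passes from `L₂` to `L₁` on the input, the other from a pointwise bound
to `L₂` on the output. -/
theorem powersSummable {A : L2e n →L[ℝ] L2e n} {a : ℝ → Matrix (Fin n) (Fin n) ℝ}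
    (hA : HasBoundedImpulseResponse A a) : PowersSummable (seminormT n) A := by
  intro T
  obtain ⟨C, hC⟩ := hA.exists_volterra_bound T
  set ν := timeMeasure.restrict (Iic (T : ℝ)) with hν
  have hν' : ν = volume.restrict (Icc 0 (T : ℝ)) := by
    rw [hν, timeMeasure, Measure.restrict_restrict measurableSet_Iic, inter_comm, Ici_inter_Iic]
  set D : ℝ≥0∞ := ν univ ^ (2⁻¹ : ℝ) with hD
  have hDtop : D ≠ ⊤ := ENNReal.rpow_ne_top_of_nonneg (by norm_num) (measure_ne_top _ _)
  have hI : ∀ f : L2e n, ∫⁻ s in Icc 0 (T : ℝ), ‖f.toFun s‖ₑ ≤ eNormT T f * D := by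
    intro f
    rw [← hν', ← eLpNorm_one_eq_lintegral_enorm, eNormT_eq_restrict]
    refine (eLpNorm_le_eLpNorm_mul_rpow_measure_univ (p := 1) (q := 2) (by norm_num)
      f.stronglyMeasurable.aestronglyMeasurable).trans_eq ?_
    rw [hD]
    congr 2
    norm_num
  have hbound : ∀ k f, eNormT T ((A ^ (k + 1)) f) ≤
      ENNReal.ofReal ((C * T) ^ k / k.factorial) * (C * D * D) * eNormT T f := by
    intro k f
    rw [eNormT_eq_restrict, ← hν]
    refine (eLpNorm_le_of_ae_enorm_bound (C := C * ENNReal.ofReal ((C * T) ^ k / k.factorial) *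
      (eNormT T f * D)) ?_).trans_eq ?_
    · rw [hν', ae_restrict_iff' measurableSet_Icc]
      filter_upwards [enorm_pow_succ_apply_le hC f k] with t ht htT
      refine (ht htT).trans ?_
      have := htT.1
      gcongr
      · exact htT.2
      · exact hI f
    · rw [smul_eq_mul, ENNReal.toReal_ofNat, ← hD]
      ring
  -- The identity `A^0` has no smoothing, so index 0 gets the constant 1 separately.
  refine ⟨fun j => Nat.casesOn j 1 fun k => (C * T) ^ k / k.factorial * (C * D * D).toReal,
    fun j => ?_, ?_, fun j f => ?_⟩
  · cases j with
    | zero => exact zero_le_one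
    | succ k => exact mul_nonneg (by positivity) ENNReal.toReal_nonneg
  · rw [← summable_nat_add_iff 1]
    exact (Real.summable_pow_div_factorial _).mul_right _
  · cases j with
    | zero => simp
    | succ k =>
      rw [seminormT_apply, seminormT_apply]
      have h1 := ENNReal.toReal_mono (ENNReal.mul_ne_top (ENNReal.mul_ne_top ENNReal.ofReal_ne_top
        (ENNReal.mul_ne_top (ENNReal.mul_ne_top ENNReal.coe_ne_top hDtop) hDtop))
        (eNormT_ne_top T f)) (hbound k f)
      rwa [ENNReal.toReal_mul, ENNReal.toReal_mul, ENNReal.toReal_ofReal (by positivity)] at h1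

end L2e

end DecControl

end

/-! ### The theorem in continuous and in discrete time -/

theorem corollary4 (nw nu nz ny : ℕ) :
    (∀ (P₁₁ : L2e nw →L[ℝ] L2e nz)
      (P₁₂ : L2e nu →L[ℝ] L2e nz)
      (P₂₁ : L2e nw →L[ℝ] L2e ny)
      (G : L2e nu →L[ℝ] L2e ny)
      (S : Submodule ℝ (L2e ny →L[ℝ] L2e nu)),
      P₁₁ ∈ L2e.LTI nw nz →
      P₁₂ ∈ L2e.LTI nu nz →
      P₂₁ ∈ L2e.LTI nw ny →
      G ∈ L2e.LTI nu ny →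
      (S : Set (L2e ny →L[ℝ] L2e nu)) ⊆ L2e.LTI ny nu →
      IsClosed[L2e.opTopology ny nu]
        (S : Set (L2e ny →L[ℝ] L2e nu)) →
      L2e.IsInert (S : Set (L2e ny →L[ℝ] L2e nu)) G →
      (∃ L : L2e nz →L[ℝ] L2e nu,
        L ∘L P₁₂ = ContinuousLinearMap.id ℝ (L2e nu)) →
      (∃ R : L2e ny →L[ℝ] L2e nw,
        P₂₁ ∘L R = ContinuousLinearMap.id ℝ (L2e ny)) →
      (∀ K ∈ S, IsUnit (1 - G ∘L K)) ∧
      (QuadraticallyInvariant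
          (S : Set (L2e ny →L[ℝ] L2e nu)) G ↔
        Convex ℝ (closedLoopMaps P₁₁ P₁₂ P₂₁ G
          (S : Set (L2e ny →L[ℝ] L2e nu))))) ∧
    (∀ (P₁₁ : ell2e nw →L[ℝ] ell2e nz)
      (P₁₂ : ell2e nu →L[ℝ] ell2e nz)
      (P₂₁ : ell2e nw →L[ℝ] ell2e ny)
      (G : ell2e nu →L[ℝ] ell2e ny)
      (S : Submodule ℝ (ell2e ny →L[ℝ] ell2e nu)),
      P₁₁ ∈ ell2e.LTI nw nz →
      P₁₂ ∈ ell2e.LTI nu nz →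
      P₂₁ ∈ ell2e.LTI nw ny →
      G ∈ ell2e.LTI nu ny →
      (S : Set (ell2e ny →L[ℝ] ell2e nu)) ⊆ ell2e.LTI ny nu →
      IsClosed[ell2e.opTopology ny nu]
        (S : Set (ell2e ny →L[ℝ] ell2e nu)) →
      ell2e.IsInert (S : Set (ell2e ny →L[ℝ] ell2e nu)) G →
      (∃ L : ell2e nz →L[ℝ] ell2e nu,
        L ∘L P₁₂ = ContinuousLinearMap.id ℝ (ell2e nu)) →
      (∃ R : ell2e ny →L[ℝ] ell2e nw,
        P₂₁ ∘L R = ContinuousLinearMap.id ℝ (ell2e ny)) →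
      (∀ K ∈ S, IsUnit (1 - G ∘L K)) ∧
      (QuadraticallyInvariant
          (S : Set (ell2e ny →L[ℝ] ell2e nu)) G ↔
        Convex ℝ (closedLoopMaps P₁₁ P₁₂ P₂₁ G
          (S : Set (ell2e ny →L[ℝ] ell2e nu))))) := by
  refine ⟨?_, ?_⟩
  · intro P₁₁ P₁₂ P₂₁ G S _ _ _ _ _ hS hI hL hR
    -- Truncated norms are always finite, so the extended norm and the real seminorm define the same
    -- operator topology.
    have htop : L2e.opTopology ny nu = opTopologyOf (L2e.eNorm : L2e ny → ℝ≥0∞)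
        fun T f => ENNReal.ofReal (L2e.seminormT nu T f) := by
      unfold L2e.opTopology
      congr 1
      funext T f
      exact L2e.eNormT_eq_ofReal T f
    rw [htop] at hS
    refine isUnit_and_quadraticallyInvariant_iff_convex (L2e.withSeminorms ny)
      (L2e.withSeminorms nu) (L2e.seriesComplete ny) (L2e.separates ny) L2e.seminormT_le_one
      P₁₁ P₁₂ P₂₁ G S hS (fun K hK => ?_) hL hR
    obtain ⟨a, ha⟩ := hI K hK
    exact L2e.powersSummable ha
  · intro P₁₁ P₁₂ P₂₁ G S _ _ _ hG hSLTI hS hI hL hR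
    have htop : ell2e.opTopology ny nu = opTopologyOf (ell2e.eNorm : ell2e ny → ℝ≥0∞)
        fun T f => ENNReal.ofReal (ell2e.seminormT nu T f) := by
      unfold ell2e.opTopology
      congr 1
      funext T f
      exact ell2e.eNormT_eq_ofReal T f
    rw [htop] at hS
    exact isUnit_and_quadraticallyInvariant_iff_convex (ell2e.withSeminorms ny)
      (ell2e.withSeminorms nu) (ell2e.seriesComplete ny) (ell2e.separates ny)
      ell2e.seminormT_le_one P₁₁ P₁₂ P₂₁ G S hS
      (fun K hK => ell2e.powersSummable (ell2e.comp_mem_LTI hG (hSLTI hK)) (hI K hK)) hL hR
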